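/- **Setting.** Let $f:\mathbb R^d\to\mathbb R$ ($d\ge 1$) be locally Lipschitz with optimal value $f^\ast$ and nonempty solution set $\mathcal X_\ast=\operatorname{argmin} f$; let $\bar x\in\mathcal X_\ast$ and $\delta>0$, and let $B_r(\bar x)$ be the open ball. Let $\mu,\eta,C_{(b)},L>0$ and assume: * (sharpness) $f(x)-f^\ast\ge\mu\,\mathrm{dist}(x,\mathcal X_\ast)$ for all $x\in B_\delta(\bar x)$; * ($(b)$-regularity) $g:\mathbb R^d\rightrightarrows\mathbb R^d$ is a nonempty-valued set-valued map that maps bounded sets to bounded sets, and $|f(x)+\langle v,y-x\rangle-f^\ast|\le C_{(b)}\|y-x\|^{1+\eta}$ for all $x\in B_\delta(\bar x)$, $v\in g(x)$, $y\in\mathcal X_\ast\cap B_{2\delta}(\bar x)$; * $\|v\|\le L$ for all $v\in g(x)$, $x\in B_\delta(\bar x)$, and $f$ is $L$-Lipschitz on $B_\delta(\bar x)$. Put $\kappa=L/\mu$ and $\rho=\sqrt{1-(2\kappa)^{-2}}$. **Algorithms.** In all of them, elements of $g$ are chosen arbitrarily. *PolyakBundle$(x,\tau)$*: set $y_0=x$;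 for $i=1,\dots,d$ choose $v_{i-1}\in g(y_{i-1})$ and set $y_i=y_0-A_i^\dagger\,[\,f(y_j)-f^\ast+\langle v_j,y_0-y_j\rangle\,]_{j=0}^{i-1}$, where $A_i$ has rows $v_0^{\mathsf T},\dots,v_{i-1}^{\mathsf T}$ and $\dagger$ is the Moore–Penrose pseudoinverse. Return a $y_i$ of least value $f(y_i)$ among the $i\in\{1,\dots,d\}$ with $\|y_i-y_0\|\le\tau(f(y_0)-f^\ast)$, or $\emptyset$ if there is none. A call uses $d$ evaluations of $g$. *PolyakSGM$(z_0,\epsilon')$*: for $i=0,1,\dots$ choose $v_i\in g(z_i)$ (one evaluation of $g$); if $v_i=0$ return $z_i$; otherwise set $z_{i+1}=z_i-\frac{f(z_i)-f^\ast}{\|v_i\|^2}v_i$ and return $z_{i+1}$ as soon as $f(z_{i+1})-f^\ast\le\epsilon'$. *SuperPolyak$(x_0,\epsilon)$*: for $k=0,1,\dots$ let $\tilde x=$ PolyakBundle$(x_k,(3/2)^k)$. If $\tilde x\ne\emptyset$ and $f(\tilde x)-f^\ast<\frac12(f(x_k)-f^\ast)$, set $x_{k+1}=\tilde x$; otherwise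 set $x_{k+1}=$ PolyakSGM$(x_k,\frac12(f(x_k)-f^\ast))$. If $f(x_{k+1})-f^\ast\le\epsilon$, return $x_{k+1}$. **Claim.** There is a constant $C_{\mathsf s}>0$, depending only on $d,\eta,\mu,L,C_{(b)}$, such that the following two statements hold. 1. (Superlinear improvement) For all $\tau>3/\mu$ and all $x$ with $\|x-\bar x\|<\delta/4$ and $\mathrm{dist}(x,\mathcal X_\ast)\le\min\{(\mu/(2C_{(b)}))^{1/\eta},(\mu^{1-\eta}/(LC_{\mathsf s}))^{1/\eta}\}$, every output $\tilde x$ of PolyakBundle$(x,\tau)$ is a point (not $\emptyset$) and satisfies $f(\tilde x)-f^\ast\le C_{\mathsf s}(f(x)-f^\ast)^{1+\eta}$. 2. Let $x_0\notin\mathcal X_\ast$ satisfy, with $\theta=1+\max\{2\kappa\frac{1+\rho}{1-\rho},\frac{4L}{3}\}$, $$\|x_0-\bar x\|\le\Big(\tfrac{2}{1-\rho}\,\theta\Big)^{-1}\frac{\delta}{4},\qquad \mathrm{dist}(x_0,\mathcal X_\ast)\le\frac1\theta\Big(\frac{\mu}{4C_{(b)}}\Big)^{1/\eta}.$$ Let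 $\Delta=f(x_0)-f^\ast$ and $$K_1=\Big\lceil\max\Big\{\log_2\Big(\Delta\max\Big\{2(2C_{\mathsf s})^{1/\eta},\ \tfrac{(2C_{(b)})^{1/\eta}}{\mu^{1+1/\eta}},\ (\kappa C_{\mathsf s})^{1/\eta}\Big\}\Big),\ \log_{3/2}\big(\tfrac3\mu\big)\Big\}\Big\rceil .$$ Then for every $\epsilon>0$ and all choices of the elements of $g$ and of the minimizers in PolyakBundle, SuperPolyak$(x_0,\epsilon)$ terminates and returns a point $x$ with $f(x)-f^\ast\le\epsilon$, after at most $$\max\{d,\lceil 8\kappa^2\log(2\kappa)\rceil\}\cdot\max\{K_1,0\}+d\,M(\epsilon)$$ evaluations of $g$, where $M(\epsilon)=\Big\lceil\frac{\log\log_2(1/\epsilon)}{\log(1+\eta)}\Big\rceil$ if $\epsilon<\frac12$, and $M(\epsilon)=1$ if $\epsilon\ge\frac12$. -/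

import Mathlib

noncomputable section

namespace SuperPolyak

open Matrix

/-- The Euclidean space of dimension `d`. -/
abbrev E (d : ℕ) := EuclideanSpace ℝ (Fin d)

/-! ### The Moore-Penrose pseudoinverse -/

/-- `B` satisfies the four Penrose equations for the real matrix `A`. -/
structure IsMoorePenrose {m n : ℕ} (A : Matrix (Fin m) (Fin n) ℝ)
    (B : Matrix (Fin n) (Fin m) ℝ) : Prop where
  aba : A * B * A = A
  bab : B * A * B = B
  ab_symm : (A * B)ᵀ = A * B
  ba_symm : (B * A)ᵀ = B * A

theorem IsMoorePenrose.unique {m n : ℕ} {A : Matrix (Fin m) (Fin n) ℝ}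
    {B C : Matrix (Fin n) (Fin m) ℝ} (hB : IsMoorePenrose A B) (hC : IsMoorePenrose A C) :
    B = C := by
  have h1 : A * B = A * C := by
    calc A * B = (A * B)ᵀ := hB.ab_symm.symm
      _ = ((A * C) * (A * B))ᵀ := by
          rw [← Matrix.mul_assoc (A * C) A B, hC.aba]
      _ = (A * B) * (A * C) := by rw [transpose_mul, hB.ab_symm, hC.ab_symm]
      _ = A * C := by rw [← Matrix.mul_assoc (A * B) A C, hB.aba]
  have h2 : B * A = C * A := by
    calc B * A = (B * A)ᵀ := hB.ba_symm.symm
      _ = ((B * A) * (C * A))ᵀ := by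
          rw [Matrix.mul_assoc B A (C * A), ← Matrix.mul_assoc A C A, hC.aba]
      _ = (C * A) * (B * A) := by rw [transpose_mul, hB.ba_symm, hC.ba_symm]
      _ = C * A := by
          rw [Matrix.mul_assoc C A (B * A), ← Matrix.mul_assoc A B A, hB.aba]
  calc B = B * A * B := hB.bab.symm
    _ = C * (A * B) := by rw [h2, Matrix.mul_assoc]
    _ = C := by rw [h1, ← Matrix.mul_assoc, hC.bab]

theorem exists_isMoorePenrose {m n : ℕ} (A : Matrix (Fin m) (Fin n) ℝ) :
    ∃ B, IsMoorePenrose A B := by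
  have hH : (Aᵀ * A).IsHermitian := by
    simpa [conjTranspose_eq_transpose_of_trivial] using isHermitian_conjTranspose_mul_self A
  obtain ⟨U, D, hU, hU2, hs⟩ : ∃ (U : Matrix (Fin n) (Fin n) ℝ) (D : Fin n → ℝ),
      Uᵀ * U = 1 ∧ U * Uᵀ = 1 ∧ Aᵀ * A = U * diagonal D * Uᵀ := by
    refine ⟨hH.eigenvectorUnitary, hH.eigenvalues, ?_, ?_, ?_⟩
    · simpa [star_eq_conjTranspose, conjTranspose_eq_transpose_of_trivial] using
        Unitary.coe_star_mul_self hH.eigenvectorUnitary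
    · simpa [star_eq_conjTranspose, conjTranspose_eq_transpose_of_trivial] using
        Unitary.coe_mul_star_self hH.eigenvectorUnitary
    · have h := hH.spectral_theorem
      rw [Unitary.conjStarAlgAut_apply] at h
      simpa [star_eq_conjTranspose, conjTranspose_eq_transpose_of_trivial,
        Function.comp_def] using h
  set P : Matrix (Fin n) (Fin n) ℝ := U * diagonal (fun i => (D i)⁻¹) * Uᵀ with hP
  have conj_mul : ∀ X Y : Matrix (Fin n) (Fin n) ℝ,
      (U * X * Uᵀ) * (U * Y * Uᵀ) = U * (X * Y) * Uᵀ := by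
    intro X Y
    calc (U * X * Uᵀ) * (U * Y * Uᵀ) = U * X * (Uᵀ * U) * Y * Uᵀ := by
          simp only [Matrix.mul_assoc]
      _ = U * (X * Y) * Uᵀ := by rw [hU]; simp only [Matrix.mul_one, Matrix.mul_assoc]
  have hPH : P * (Aᵀ * A) = U * diagonal (fun i => (D i)⁻¹ * D i) * Uᵀ := by
    rw [hs, hP, conj_mul, diagonal_mul_diagonal]
  have hHPH : (Aᵀ * A) * (P * (Aᵀ * A)) = Aᵀ * A := by
    rw [hPH, hs, conj_mul, diagonal_mul_diagonal]
    congr 3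
    ext i
    by_cases h : D i = 0 <;> simp [h]
  have hPHP : P * (Aᵀ * A) * P = P := by
    rw [hPH, hP, conj_mul, diagonal_mul_diagonal]
    congr 3
    ext i
    by_cases h : D i = 0 <;> simp [h]
  have hPt : Pᵀ = P := by
    rw [hP]; simp [transpose_mul, Matrix.mul_assoc]
  have hPHt : (P * (Aᵀ * A))ᵀ = P * (Aᵀ * A) := by
    rw [hPH]; simp [transpose_mul, Matrix.mul_assoc]
  refine ⟨P * Aᵀ, ?_, ?_, ?_, ?_⟩
  · have h0 : (A * (P * (Aᵀ * A)) - A)ᴴ * (A * (P * (Aᵀ * A)) - A) = 0 := by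
      have h1 : Aᵀ * (A * (P * (Aᵀ * A)) - A) = 0 := by
        rw [Matrix.mul_sub, ← Matrix.mul_assoc Aᵀ A, hHPH, sub_self]
      have h2 : (A * (P * (Aᵀ * A)) - A)ᴴ = (P * (Aᵀ * A) - 1)ᵀ * Aᵀ := by
        rw [conjTranspose_eq_transpose_of_trivial, ← transpose_mul, Matrix.mul_sub,
          Matrix.mul_one]
      rw [h2, Matrix.mul_assoc, h1, Matrix.mul_zero]
    have h3 := sub_eq_zero.mp (conjTranspose_mul_self_eq_zero.mp h0)
    calc A * (P * Aᵀ) * A = A * (P * (Aᵀ * A)) := by simp only [Matrix.mul_assoc]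
      _ = A := h3
  · calc P * Aᵀ * A * (P * Aᵀ) = P * (Aᵀ * A) * P * Aᵀ := by simp only [Matrix.mul_assoc]
      _ = P * Aᵀ := by rw [hPHP]
  · simp [transpose_mul, hPt, Matrix.mul_assoc]
  · rw [Matrix.mul_assoc, hPHt]

/-- The Moore-Penrose pseudoinverse of a real matrix. -/
def pinv {m n : ℕ} (A : Matrix (Fin m) (Fin n) ℝ) : Matrix (Fin n) (Fin m) ℝ :=
  Classical.choose (exists_isMoorePenrose A)

theorem pinv_spec {m n : ℕ} (A : Matrix (Fin m) (Fin n) ℝ) : IsMoorePenrose A (pinv A) :=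
  Classical.choose_spec (exists_isMoorePenrose A)

/-! ### The problem and the assumptions -/

/-- The solution set: all global minimizers of `f`. -/
def solutionSet {d : ℕ} (f : E d → ℝ) : Set (E d) := {x | ∀ y, f x ≤ f y}

/-- The optimal value of `f`. -/
def optVal {d : ℕ} (f : E d → ℝ) : ℝ := ⨅ x, f x

/-- The function gap. -/
def gap {d : ℕ} (f : E d → ℝ) (x : E d) : ℝ := f x - optVal f

/-- Sharp growth on the open ball of radius `δ` about `xbar`. -/
def Sharp {d : ℕ} (f : E d → ℝ) (xbar : E d) (δ μ : ℝ) : Prop :=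
  ∀ x ∈ Metric.ball xbar δ, μ * Metric.infDist x (solutionSet f) ≤ gap f x

/-- A set-valued map is locally bounded if it maps bounded sets to bounded sets. -/
def MapsBoundedToBounded {d : ℕ} (g : E d → Set (E d)) : Prop :=
  ∀ S : Set (E d), Bornology.IsBounded S → Bornology.IsBounded (⋃ x ∈ S, g x)

/-- The `(b)`-regularity estimate with constant `Cb` and exponent `1 + η`. -/
def BRegular {d : ℕ} (f : E d → ℝ) (g : E d → Set (E d)) (xbar : E d) (δ Cb η : ℝ) : Prop :=
  ∀ x ∈ Metric.ball xbar δ, ∀ v ∈ g x, ∀ y ∈ solutionSet f ∩ Metric.ball xbar (2 * δ),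
    |f x + inner ℝ v (y - x) - optVal f| ≤ Cb * ‖y - x‖ ^ (1 + η)

/-! ### PolyakBundle -/

/-- The matrix with rows `v 0, …, v (i - 1)`. -/
def rowMatrix {d : ℕ} (v : ℕ → E d) (i : ℕ) : Matrix (Fin i) (Fin d) ℝ :=
  Matrix.of fun j c => v j c

/-- The vector with entries `f (y j) - fstar + ⟪v j, y 0 - y j⟫`, for `j < i`. -/
def residual {d : ℕ} (f : E d → ℝ) (y v : ℕ → E d) (i : ℕ) : Fin i → ℝ :=
  fun j => gap f (y j) + inner ℝ (v j) (y 0 - y j)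

/-- `y 0, …, y d` and `v 0, …, v (d - 1)` are the points and the generalized gradients produced
by the loop of PolyakBundle started at `x`; each `v i` is an arbitrary element of `g (y i)`.
The loop makes one evaluation of `g` for each `i < d`, that is, `d` evaluations in all (an element
of `g (y d)` would not be used in any of the points, and is not requested). -/
structure IsBundleTrace {d : ℕ} (f : E d → ℝ) (g : E d → Set (E d)) (x : E d)
    (y v : ℕ → E d) : Prop where
  start : y 0 = x
  eval : ∀ i < d, v i ∈ g (y i)
  update : ∀ i, 1 ≤ i → i ≤ d →
    y i = y 0 - WithLp.toLp 2 (pinv (rowMatrix v i) *ᵥ residual f y v i)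

/-- The indices that compete in the last line of PolyakBundle. -/
def bundleCandidates {d : ℕ} (f : E d → ℝ) (τ : ℝ) (y : ℕ → E d) : Set ℕ :=
  {i | 1 ≤ i ∧ i ≤ d ∧ ‖y i - y 0‖ ≤ τ * gap f (y 0)}

/-- `BundleOutput f g x τ o`: some execution of `PolyakBundle(x, τ)` has the output `o`.
Here `none` is the empty output, returned when no index competes; ties in the minimization are
broken arbitrarily. -/
inductive BundleOutput {d : ℕ} (f : E d → ℝ) (g : E d → Set (E d)) (x : E d) (τ : ℝ) :
    Option (E d) → Prop
  | point (y v : ℕ → E d) (h : IsBundleTrace f g x y v) (s : ℕ)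
      (hs : s ∈ bundleCandidates f τ y)
      (hmin : ∀ i ∈ bundleCandidates f τ y, f (y s) ≤ f (y i)) :
      BundleOutput f g x τ (some (y s))
  | empty (y v : ℕ → E d) (h : IsBundleTrace f g x y v)
      (hempty : bundleCandidates f τ y = ∅) :
      BundleOutput f g x τ none

/-- `Cs` is a constant of superlinear improvement: for every scalar `τ > 3 / μ` and every point `x`
of the indicated region, every output of `PolyakBundle(x, τ)` is a point whose function gap is at
most `Cs` times the gap of `x` to the power `1 + η`. -/
def IsSuperlinearConstant {d : ℕ} (f : E d → ℝ) (g : E d → Set (E d)) (xbar : E d)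
    (δ μ L Cb η Cs : ℝ) : Prop :=
  ∀ τ : ℝ, 3 / μ < τ → ∀ x : E d, ‖x - xbar‖ < δ / 4 →
    Metric.infDist x (solutionSet f) ≤
      min ((μ / (2 * Cb)) ^ (1 / η)) ((μ ^ (1 - η) / (L * Cs)) ^ (1 / η)) →
    ∀ o, BundleOutput f g x τ o →
      ∃ xt, o = some xt ∧ gap f xt ≤ Cs * gap f x ^ (1 + η)

/-! ### SuperPolyak with PolyakSGM as the fallback algorithm -/

/-- Control states of the algorithm.
* `main k x`: iteration `k` is about to start at the iterate `x`;
* `fallback k x z`: in iteration `k`, at the iterate `x`, the call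
  `PolyakSGM(x, gap(x) / 2)` is running, with current point `z`;
* `returned x`: the algorithm has returned `x`. -/
inductive Control (d : ℕ)
  | main (k : ℕ) (x : E d)
  | fallback (k : ℕ) (x z : E d)
  | returned (x : E d)

/-- A configuration: the control state, and the number of evaluations of `g` made so far. -/
structure Config (d : ℕ) where
  control : Control d
  evals : ℕ

/-- The end of iteration `k`, where `x` has just become the next iterate: return it if its gap is
at most `ε`, go on to iteration `k + 1` otherwise. -/
def finish {d : ℕ} (f : E d → ℝ) (ε : ℝ) (k : ℕ) (x : E d) : Control d :=
  open Classical in if gap f x ≤ ε then .returned x else .main (k + 1) x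

/-- The Polyak subgradient step from `z` along `v`. -/
def polyakStep {d : ℕ} (f : E d → ℝ) (z v : E d) : E d := z - (gap f z / ‖v‖ ^ 2) • v

/-- The output `o` of PolyakBundle at `x` is nonempty and (strictly) halves the gap. -/
def Halves {d : ℕ} (f : E d → ℝ) (x : E d) (o : Option (E d)) : Prop :=
  ∃ xt, o = some xt ∧ gap f xt < 1 / 2 * gap f x

/-- One step of the algorithm: a call of PolyakBundle, which costs `d` evaluations of `g`, or one
iteration of PolyakSGM, which costs one. The elements of `g` are chosen arbitrarily. -/
inductive Step {d : ℕ} (f : E d → ℝ) (g : E d → Set (E d)) (ε : ℝ) : Config d → Config d → Prop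
  | bundle_success (k : ℕ) (x xt : E d) (n : ℕ)
      (ho : BundleOutput f g x ((3 / 2 : ℝ) ^ k) (some xt)) (h : Halves f x (some xt)) :
      Step f g ε ⟨.main k x, n⟩ ⟨finish f ε k xt, n + d⟩
  | bundle_failure (k : ℕ) (x : E d) (o : Option (E d)) (n : ℕ)
      (ho : BundleOutput f g x ((3 / 2 : ℝ) ^ k) o) (h : ¬ Halves f x o) :
      Step f g ε ⟨.main k x, n⟩ ⟨.fallback k x x, n + d⟩
  | sgm_zero (k : ℕ) (x z : E d) (n : ℕ) (hv : (0 : E d) ∈ g z) :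
      Step f g ε ⟨.fallback k x z, n⟩ ⟨finish f ε k z, n + 1⟩
  | sgm_halved (k : ℕ) (x z v : E d) (n : ℕ) (hv : v ∈ g z) (hne : v ≠ 0)
      (h : gap f (polyakStep f z v) ≤ 1 / 2 * gap f x) :
      Step f g ε ⟨.fallback k x z, n⟩ ⟨finish f ε k (polyakStep f z v), n + 1⟩
  | sgm_continue (k : ℕ) (x z v : E d) (n : ℕ) (hv : v ∈ g z) (hne : v ≠ 0)
      (h : ¬ gap f (polyakStep f z v) ≤ 1 / 2 * gap f x) :
      Step f g ε ⟨.fallback k x z, n⟩ ⟨.fallback k x (polyakStep f z v), n + 1⟩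
  | idle (x : E d) (n : ℕ) : Step f g ε ⟨.returned x, n⟩ ⟨.returned x, n⟩

/-- `s` is a run of the algorithm from the initial point `x₀`, with some choice of the elements of
`g` and of the minimizers in PolyakBundle; after the algorithm has returned, the run idles. -/
structure IsRun {d : ℕ} (f : E d → ℝ) (g : E d → Set (E d)) (ε : ℝ) (x₀ : E d)
    (s : ℕ → Config d) : Prop where
  init : s 0 = ⟨.main 0 x₀, 0⟩
  step : ∀ n, Step f g ε (s n) (s (n + 1))

/-- Every run returns a point with gap at most `ε`, and has by then made at most `N` evaluations
of `g`. -/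
def TerminatesWithin {d : ℕ} (f : E d → ℝ) (g : E d → Set (E d)) (ε : ℝ) (x₀ : E d)
    (N : ℝ) : Prop :=
  ∀ s, IsRun f g ε x₀ s →
    ∃ n x, (s n).control = .returned x ∧ gap f x ≤ ε ∧ ((s n).evals : ℝ) ≤ N

theorem exists_bundleTrace {d : ℕ} (f : E d → ℝ) {g : E d → Set (E d)}
    (hg : ∀ x, (g x).Nonempty) (x : E d) : ∃ y v, IsBundleTrace f g x y v := by
  suffices h : ∀ m : ℕ, ∃ y v : ℕ → E d, y 0 = x ∧ (∀ i < m, v i ∈ g (y i)) ∧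
      ∀ i, 1 ≤ i → i ≤ m →
        y i = y 0 - WithLp.toLp 2 (pinv (rowMatrix v i) *ᵥ residual f y v i) by
    obtain ⟨y, v, h0, h1, h2⟩ := h d
    exact ⟨y, v, h0, h1, h2⟩
  intro m
  induction m with
  | zero => exact ⟨fun _ => x, fun _ => 0, rfl, by simp, by intro i h1 h2; omega⟩
  | succ m ih =>
    obtain ⟨y, v, h0, h1, h2⟩ := ih
    obtain ⟨w, hw⟩ := hg (y m)
    let v' := Function.update v m w
    let y' := Function.update y (m + 1)
      (y 0 - WithLp.toLp 2 (pinv (rowMatrix v' (m + 1)) *ᵥ residual f y v' (m + 1)))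
    have hy : ∀ i, i ≤ m → y' i = y i := fun i hi =>
      Function.update_of_ne (by omega) _ _
    have hv : ∀ i, i < m → v' i = v i := fun i hi =>
      Function.update_of_ne (by omega) _ _
    have hr : ∀ i, i ≤ m + 1 → residual f y' v' i = residual f y v' i := by
      intro i hi
      ext j
      have := j.2
      simp only [residual, hy j (by omega), hy 0 (by omega)]
    refine ⟨y', v', by rw [hy 0 (by omega), h0], ?_, ?_⟩
    · intro i hi
      rw [hy i (by omega)]
      rcases Nat.lt_succ_iff_lt_or_eq.mp hi with h | h
      · rw [hv i h]; exact h1 i h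
      · subst h; simpa [v'] using hw
    · intro i hi1 hi2
      rw [hr i hi2, hy 0 (by omega)]
      rcases Nat.lt_or_ge m i with h | h
      · obtain rfl : i = m + 1 := by omega
        simp [y']
      · have e1 : rowMatrix v' i = rowMatrix v i := by
          ext j c
          have := j.2
          simp [rowMatrix, hv j (by omega)]
        have e2 : residual f y v' i = residual f y v i := by
          ext j
          have := j.2
          simp [residual, hv j (by omega)]
        rw [hy i h, e1, e2]
        exact h2 i hi1 h

theorem exists_bundleOutput {d : ℕ} (f : E d → ℝ) {g : E d → Set (E d)}
    (hg : ∀ x, (g x).Nonempty) (x : E d) (τ : ℝ) : ∃ o, BundleOutput f g x τ o := by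
  obtain ⟨y, v, h⟩ := exists_bundleTrace f hg x
  rcases (bundleCandidates f τ y).eq_empty_or_nonempty with he | hne
  · exact ⟨_, .empty y v h he⟩
  · have hfin : (bundleCandidates f τ y).Finite :=
      (Set.finite_Iic d).subset fun i hi => hi.2.1
    obtain ⟨s, hs, hmin⟩ := Set.exists_min_image _ (fun i => f (y i)) hfin hne
    exact ⟨_, .point y v h s hs hmin⟩

/-- The algorithm is never stuck. -/
theorem exists_step {d : ℕ} (f : E d → ℝ) {g : E d → Set (E d)}
    (hg : ∀ x, (g x).Nonempty) (ε : ℝ) (c : Config d) : ∃ c', Step f g ε c c' := by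
  obtain ⟨_ | _ | _, n⟩ := c
  · rename_i k x
    obtain ⟨o, ho⟩ := exists_bundleOutput f hg x ((3 / 2 : ℝ) ^ k)
    by_cases h : Halves f x o
    · obtain ⟨xt, rfl, h'⟩ := id h
      exact ⟨_, .bundle_success k x xt n ho h⟩
    · exact ⟨_, .bundle_failure k x o n ho h⟩
  · rename_i k x z
    obtain ⟨v, hv⟩ := hg z
    by_cases h0 : v = 0
    · exact ⟨_, .sgm_zero k x z n (h0 ▸ hv)⟩
    · by_cases h : gap f (polyakStep f z v) ≤ 1 / 2 * gap f x
      · exact ⟨_, .sgm_halved k x z v n hv h0 h⟩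
      · exact ⟨_, .sgm_continue k x z v n hv h0 h⟩
  · exact ⟨_, .idle _ n⟩

/-- Runs exist. -/
theorem exists_run {d : ℕ} (f : E d → ℝ) {g : E d → Set (E d)}
    (hg : ∀ x, (g x).Nonempty) (ε : ℝ) (x₀ : E d) : ∃ s, IsRun f g ε x₀ s := by
  choose F hF using exists_step f hg ε
  exact ⟨fun n => F^[n] ⟨.main 0 x₀, 0⟩, rfl, fun n => by
    rw [Function.iterate_succ_apply']; exact hF _⟩

/-! ### The constants of the complexity bound -/

/-- The contraction factor of PolyakSGM. -/
def rho (κ : ℝ) : ℝ := Real.sqrt (1 - ((2 * κ) ^ 2)⁻¹)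

/-- The factor in the initialization bounds. -/
def initFactor (κ L : ℝ) : ℝ :=
  1 + max (2 * κ * ((1 + rho κ) / (1 - rho κ))) (4 * L / 3)

/-- The iteration count of the first phase, as an integer (it may be negative). -/
def K₁ (Δ μ L Cb η Cs : ℝ) : ℤ :=
  ⌈max
    (Real.logb 2 (Δ * max (max (2 * (2 * Cs) ^ (1 / η)) ((2 * Cb) ^ (1 / η) / μ ^ (1 + 1 / η)))
      ((L / μ * Cs) ^ (1 / η))))
    (Real.logb (3 / 2) (3 / μ))⌉

/-- The iteration count of the second, superlinear phase. The double logarithm is positive for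
`ε < 1 / 2`; for larger `ε` the count is `1`. -/
def superlinearCount (η ε : ℝ) : ℤ :=
  open Classical in
  if ε < 1 / 2 then ⌈Real.log (Real.logb 2 (1 / ε)) / Real.log (1 + η)⌉ else 1

end SuperPolyak

end

open SuperPolyak

/-!
Everything rests on two estimates that hold near the minimizer `xbar`, and on the freedom to choose
the constant `Cs` large.

*Superlinear improvement* (`exists_superlinear`). Let `r = dist(x, X⋆)` and let `y i` be the bundle
points, `v i` the gradients. If `v 0, …, v (i - 1)` are independent, then `y i` solves the linearized
equations exactly, and `(b)`-regularity says that every minimizer `w` within `O(r)` of these points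
solves them up to an error `O(r ^ (1 + η))`. Hence `y i - w` is superlinearly small along the span of
the gradients, as long as they are well conditioned. With `w` the minimizer nearest to `y i`, sharpness
and `(b)`-regularity give `⟪v i, y i - w⟫ ≥ (μ / 2) * ‖y i - w‖`; so either `y i` already has distance
`O(r ^ (1 + η))` from the solutions, or `v i` has a component of norm at least `μ / 4` orthogonal to
the earlier gradients (`IsSharpRegular.wellConditioned_of_lt_infDist`), and well-conditioning
persists. The second case cannot occur `d + 1` times. No bound for singular values is needed: the
conditioning enters through the elementary recursion of `norm_le_of_mem_prefixSpan`.

*Linear decrease* (`IsSharpRegular.infDist_polyakStep_le`, `rho_pow_le`). A Polyak step contracts the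
distance to the solutions by the factor `ρ`, so that `S = ⌈8 κ² log (2 κ)⌉` steps halve the gap.

A run therefore halves its gap in every iteration, at a cost of at most `d + S` evaluations, and from
some iteration on it pays only `d` evaluations for a superlinear improvement. This is organized by
invariants of the configurations (`IsSharpRegular.runInv_step`) relative to a schedule of gap bounds
(`IsSchedule`): if `T` iterations suffice and PolyakBundle is bound to succeed from iteration `N` on,
then the cost is at most `d * T + S * min T N` (`IsSharpRegular.terminatesWithin_of_schedule`).

The claimed bound charges `max d S` rather than `d + S` per iteration of the first phase. Let `W` be
the number of halvings that bring every admissible initial gap into the superlinear region, and let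
`n` be the first index with `(3 / 2) ^ n ≥ 3 / μ`. Since `K₁` grows with `Cs`, a large `Cs` makes
`K₁ ≥ 2 * W` unless the initial gap is below a fixed small threshold, and `2 * W * max d S` pays for
`W` iterations of cost `d + S` (`isSchedule_of_halving`). Below the threshold the initial gap is so
small that the first `n ≤ K₁` iterations are already accounted for, as far as their calls of
PolyakBundle are concerned, in the doubly logarithmic count of the second phase, so that only their
calls of PolyakSGM have to be charged to the first phase (`isSchedule_of_gap_le`).
-/

namespace SuperPolyak

open Matrix

/-! ### Well-conditioned families of vectors -/

/-- The span of `v 0, …, v (i - 1)`. -/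
abbrev prefixSpan {d : ℕ} (v : ℕ → E d) (i : ℕ) : Submodule ℝ (E d) :=
  Submodule.span ℝ (v '' Set.Iio i)

/-- The component of `v i` orthogonal to `v 0, …, v (i - 1)`. -/
noncomputable def orthPart {d : ℕ} (v : ℕ → E d) (i : ℕ) : E d :=
  v i - (prefixSpan v i).starProjection (v i)

/-- Among `v 0, …, v (i - 1)`, every vector has distance at least `c` from the span of the previous
ones. -/
def WellConditioned {d : ℕ} (v : ℕ → E d) (c : ℝ) (i : ℕ) : Prop :=
  ∀ j < i, c ≤ ‖orthPart v j‖

/-- A bound for the norm of the inverse of `u ↦ (⟪v j, u⟫)_j`, as a map from the span of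
`v 0, …, v (i - 1)` to `ℝⁱ` with the maximum norm, when these vectors are well conditioned with
constant `c` and have norm at most `L`. -/
noncomputable def condBound (L c : ℝ) : ℕ → ℝ
  | 0 => 0
  | i + 1 => condBound L c i + (1 + L * condBound L c i) / c

theorem condBound_nonneg {L c : ℝ} (hL : 0 ≤ L) (hc : 0 < c) (i : ℕ) : 0 ≤ condBound L c i := by
  induction i with
  | zero => exact le_rfl
  | succ i ih => rw [condBound]; positivity

theorem condBound_mono {L c : ℝ} (hL : 0 ≤ L) (hc : 0 < c) : Monotone (condBound L c) := by
  refine monotone_nat_of_le_succ fun i => ?_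
  have := condBound_nonneg hL hc i
  rw [condBound]
  exact le_add_of_nonneg_right (by positivity)

theorem mem_prefixSpan {d : ℕ} (v : ℕ → E d) {i j : ℕ} (h : j < i) : v j ∈ prefixSpan v i :=
  Submodule.subset_span ⟨j, h, rfl⟩

theorem prefixSpan_succ {d : ℕ} (v : ℕ → E d) (i : ℕ) :
    prefixSpan v (i + 1) = prefixSpan v i ⊔ Submodule.span ℝ {v i} := by
  have h : Set.Iio (i + 1) = insert i (Set.Iio i) := Order.Iio_succ_eq_insert i
  rw [prefixSpan, h, Set.image_insert_eq, Submodule.span_insert, sup_comm]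

theorem range_fin_eq_image_Iio {d : ℕ} (v : ℕ → E d) (i : ℕ) :
    Set.range (fun j : Fin i => v j) = v '' Set.Iio i := by
  ext u
  constructor
  · rintro ⟨j, rfl⟩
    exact ⟨j, j.2, rfl⟩
  · rintro ⟨j, hj, rfl⟩
    exact ⟨⟨j, hj⟩, rfl⟩

theorem inner_orthPart_eq_zero {d : ℕ} (v : ℕ → E d) (i : ℕ) {u : E d} (hu : u ∈ prefixSpan v i) :
    inner ℝ (orthPart v i) u = 0 := by
  rw [real_inner_comm]
  exact Submodule.inner_right_of_mem_orthogonal hu (Submodule.sub_starProjection_mem_orthogonal _)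

/-- The vectors `v 0, …, v (i - 1)` determine the elements of their span in a quantitative way. -/
theorem norm_le_of_mem_prefixSpan {d : ℕ} {v : ℕ → E d} {L c M : ℝ} (hL : 0 ≤ L) (hc : 0 < c)
    {i : ℕ} (hv : ∀ j < i, ‖v j‖ ≤ L) (hw : WellConditioned v c i) {u : E d}
    (hu : u ∈ prefixSpan v i) (hin : ∀ j < i, |inner ℝ (v j) u| ≤ M) :
    ‖u‖ ≤ condBound L c i * M := by
  induction i generalizing u with
  | zero =>
    have : u = 0 := by simpa [prefixSpan] using hu
    simp [this, condBound]
  | succ i ih =>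
    rw [prefixSpan_succ, Submodule.mem_sup] at hu
    obtain ⟨u₁, hu₁, u₂, hu₂, rfl⟩ := hu
    obtain ⟨a, rfl⟩ := Submodule.mem_span_singleton.mp hu₂
    set S := prefixSpan v i
    set p := orthPart v i with hp
    -- Replace `v i` by its orthogonal component `p` in the decomposition of the vector.
    set u' := u₁ + a • S.starProjection (v i) with hu'
    have hu'S : u' ∈ S := S.add_mem hu₁ (S.smul_mem _ (Submodule.starProjection_apply_mem _ _))
    have hdec : u₁ + a • v i = u' + a • p := by
      rw [hu', hp, orthPart, smul_sub]; abel
    rw [hdec] at hin ⊢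
    have hK := condBound_nonneg hL hc i
    have hpz : ∀ w ∈ S, inner ℝ w p = 0 := fun w hw' => by
      rw [real_inner_comm]; exact inner_orthPart_eq_zero v i hw'
    have hnu' : ‖u'‖ ≤ condBound L c i * M := by
      refine ih (fun j hj => hv j (by omega)) (fun j hj => hw j (by omega)) hu'S fun j hj => ?_
      have := hin j (by omega)
      rwa [inner_add_right, inner_smul_right, hpz _ (mem_prefixSpan v hj), mul_zero,
        add_zero] at this
    have hvp : inner ℝ (v i) p = ‖p‖ ^ 2 := by
      have : v i = S.starProjection (v i) + p := by rw [hp, orthPart]; abel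
      rw [this, inner_add_left, hpz _ (Submodule.starProjection_apply_mem _ _), zero_add,
        real_inner_self_eq_norm_sq]
    have hcp : c ≤ ‖p‖ := hw i (by omega)
    have hp0 : 0 < ‖p‖ := hc.trans_le hcp
    have hap : ‖a • p‖ ≤ (1 + L * condBound L c i) * M / c := by
      have h1 := hin i (by omega)
      rw [inner_add_right, inner_smul_right, hvp] at h1
      have h2 : |inner ℝ (v i) u'| ≤ L * (condBound L c i * M) :=
        (abs_real_inner_le_norm _ _).trans
          (mul_le_mul (hv i (by omega)) hnu' (norm_nonneg _) hL)
      have h3 : |a * ‖p‖ ^ 2| ≤ (1 + L * condBound L c i) * M := by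
        have := abs_sub (inner ℝ (v i) u' + a * ‖p‖ ^ 2) (inner ℝ (v i) u')
        rw [add_sub_cancel_left] at this
        linarith
      rw [abs_mul, abs_of_nonneg (sq_nonneg ‖p‖)] at h3
      rw [norm_smul, Real.norm_eq_abs, le_div_iff₀ hc]
      calc |a| * ‖p‖ * c ≤ |a| * ‖p‖ * ‖p‖ := by gcongr
        _ = |a| * ‖p‖ ^ 2 := by ring
        _ ≤ _ := h3
    calc ‖u' + a • p‖ ≤ ‖u'‖ + ‖a • p‖ := norm_add_le _ _
      _ ≤ condBound L c i * M + (1 + L * condBound L c i) * M / c := add_le_add hnu' hap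
      _ = condBound L c (i + 1) * M := by rw [condBound]; ring

theorem WellConditioned.linearIndependent {d : ℕ} {v : ℕ → E d} {c : ℝ} (hc : 0 < c) {i : ℕ}
    (hw : WellConditioned v c i) : LinearIndependent ℝ (fun j : Fin i => v j) := by
  induction i with
  | zero => exact linearIndependent_empty_type
  | succ i ih =>
    refine linearIndependent_finSucc'.mpr ⟨ih fun j hj => hw j (by omega), fun hmem => ?_⟩
    have hmem' : v i ∈ prefixSpan v i := by
      rw [prefixSpan, ← range_fin_eq_image_Iio]
      exact hmem
    have h0 : orthPart v i = 0 := by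
      rw [orthPart, Submodule.starProjection_eq_self_iff.mpr hmem', sub_self]
    have := hw i (by omega)
    rw [h0, norm_zero] at this
    linarith

theorem WellConditioned.prefixSpan_eq_top {d : ℕ} {v : ℕ → E d} {c : ℝ} (hd : 0 < d) (hc : 0 < c)
    (hw : WellConditioned v c d) : prefixSpan v d = ⊤ := by
  have : Nonempty (Fin d) := ⟨⟨0, hd⟩⟩
  rw [prefixSpan, ← range_fin_eq_image_Iio]
  exact (hw.linearIndependent hc).span_eq_top_of_card_eq_finrank (by simp)

/-! ### Steps along the pseudoinverse -/

theorem rowMatrix_mulVec {d : ℕ} (v : ℕ → E d) (i : ℕ) (u : E d) (j : Fin i) :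
    (rowMatrix v i *ᵥ u.ofLp) j = inner ℝ (v j) u := by
  rw [EuclideanSpace.inner_eq_star_dotProduct, Matrix.mulVec, dotProduct_comm]
  rfl

/-- The range of the pseudoinverse is the row space. -/
theorem pinv_mulVec_mem_prefixSpan {d : ℕ} (v : ℕ → E d) (i : ℕ) (b : Fin i → ℝ) :
    WithLp.toLp 2 (pinv (rowMatrix v i) *ᵥ b) ∈ prefixSpan v i := by
  set A := rowMatrix v i with hA
  have h := pinv_spec A
  have hrow : pinv A *ᵥ b = ((pinv A)ᵀ *ᵥ (pinv A *ᵥ b)) ᵥ* A := by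
    rw [← mulVec_transpose, mulVec_mulVec, mulVec_mulVec, ← transpose_mul, h.ba_symm, h.bab]
  rw [hrow, vecMul_eq_sum, WithLp.toLp_sum]
  refine Submodule.sum_mem _ fun j _ => ?_
  have : WithLp.toLp 2 (((pinv A)ᵀ *ᵥ (pinv A *ᵥ b)) j • A j)
      = ((pinv A)ᵀ *ᵥ (pinv A *ᵥ b)) j • v j := by
    ext k; rfl
  rw [this]
  exact Submodule.smul_mem _ _ (mem_prefixSpan v j.2)

/-- For independent rows the pseudoinverse is a right inverse. -/
theorem inner_pinv_mulVec {d : ℕ} {v : ℕ → E d} {i : ℕ}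
    (hv : LinearIndependent ℝ (fun j : Fin i => v j)) (b : Fin i → ℝ) (j : Fin i) :
    inner ℝ (v j) (WithLp.toLp 2 (pinv (rowMatrix v i) *ᵥ b)) = b j := by
  set A := rowMatrix v i with hA
  have h := pinv_spec A
  have hrow : LinearIndependent ℝ A.row := by
    have := hv.map' (WithLp.linearEquiv 2 ℝ (Fin d → ℝ)).toLinearMap (LinearEquiv.ker _)
    exact this
  have hinj := vecMul_injective_iff.mpr hrow
  have h1 : A * pinv A = 1 := by
    have h2 : (A * pinv A) * A = (1 : Matrix (Fin i) (Fin i) ℝ) * A := by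
      rw [h.aba, Matrix.one_mul]
    funext k
    apply hinj
    have := congrFun h2 k
    simpa only [Matrix.mul_apply_eq_vecMul] using this
  rw [← rowMatrix_mulVec, ← hA]
  change (A *ᵥ (pinv A *ᵥ b)) j = b j
  rw [mulVec_mulVec, h1, one_mulVec]

/-- The displacement of the `i`-th bundle point lies in the span of the gradients. -/
theorem IsBundleTrace.sub_mem_prefixSpan {d : ℕ} {f : E d → ℝ} {g : E d → Set (E d)} {x : E d}
    {y v : ℕ → E d} (h : IsBundleTrace f g x y v) {i : ℕ} (hi : i ≤ d) :
    y 0 - y i ∈ prefixSpan v i := by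
  rcases Nat.eq_zero_or_pos i with rfl | hi0
  · simp
  · rw [h.update i hi0 hi, sub_sub_cancel]
    exact pinv_mulVec_mem_prefixSpan v i _

/-- For independent gradients the `i`-th bundle point solves the linearized equations exactly. -/
theorem IsBundleTrace.inner_sub {d : ℕ} {f : E d → ℝ} {g : E d → Set (E d)} {x : E d}
    {y v : ℕ → E d} (h : IsBundleTrace f g x y v) {i : ℕ} (hi : i ≤ d)
    (hv : LinearIndependent ℝ (fun j : Fin i => v j)) {j : ℕ} (hj : j < i) (w : E d) :
    inner ℝ (v j) (y i - w) = -(gap f (y j) + inner ℝ (v j) (w - y j)) := by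
  have h1 : inner ℝ (v j) (y 0 - y i) = gap f (y j) + inner ℝ (v j) (y 0 - y j) := by
    rw [h.update i (by omega) hi, sub_sub_cancel]
    exact inner_pinv_mulVec hv (residual f y v i) ⟨j, hj⟩
  simp only [inner_sub_right] at h1 ⊢
  linarith

/-! ### The setting and its elementary geometry -/

/-- The assumptions on the function `f` and the generalized gradient map `g`: `f` is continuous,
sharp and Lipschitz around the minimizer `xbar`, and `g` is bounded and `(b)`-regular there. -/
structure IsSharpRegular {d : ℕ} (f : E d → ℝ) (g : E d → Set (E d)) (xbar : E d)
    (δ η μ L Cb : ℝ) : Prop where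
  hη : 0 < η
  hμ : 0 < μ
  hL : 0 < L
  hCb : 0 < Cb
  hδ : 0 < δ
  cont : Continuous f
  sol : xbar ∈ solutionSet f
  sharp : Sharp f xbar δ μ
  breg : BRegular f g xbar δ Cb η
  bound : ∀ x ∈ Metric.ball xbar δ, ∀ v ∈ g x, ‖v‖ ≤ L
  lip : ∀ x ∈ Metric.ball xbar δ, ∀ y ∈ Metric.ball xbar δ, |f x - f y| ≤ L * ‖x - y‖

theorem optVal_eq {d : ℕ} {f : E d → ℝ} {w : E d} (hw : w ∈ solutionSet f) : optVal f = f w :=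
  le_antisymm (ciInf_le ⟨f w, by rintro _ ⟨y, rfl⟩; exact hw y⟩ w) (le_ciInf hw)

namespace IsSharpRegular

variable {d : ℕ} {f : E d → ℝ} {g : E d → Set (E d)} {xbar : E d} {δ η μ L Cb : ℝ}

theorem gap_nonneg (H : IsSharpRegular f g xbar δ η μ L Cb) (x : E d) : 0 ≤ gap f x := by
  rw [gap, optVal_eq H.sol, sub_nonneg]
  exact H.sol x

theorem gap_pos (H : IsSharpRegular f g xbar δ η μ L Cb) {x : E d} (hx : x ∉ solutionSet f) :
    0 < gap f x := by
  refine (H.gap_nonneg x).lt_of_ne fun h => hx fun y => ?_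
  have := H.gap_nonneg y
  simp only [gap] at h this
  linarith

theorem isClosed_solutionSet (H : IsSharpRegular f g xbar δ η μ L Cb) :
    IsClosed (solutionSet f) := by
  have : solutionSet f = ⋂ y, {x | f x ≤ f y} := by ext; simp [solutionSet]
  rw [this]
  exact isClosed_iInter fun y => isClosed_le H.cont continuous_const

/-- Nearest minimizers exist. -/
theorem exists_proj (H : IsSharpRegular f g xbar δ η μ L Cb) (x : E d) :
    ∃ w ∈ solutionSet f, ‖x - w‖ = Metric.infDist x (solutionSet f) := by
  obtain ⟨w, hw, h⟩ := H.isClosed_solutionSet.exists_infDist_eq_dist ⟨xbar, H.sol⟩ x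
  exact ⟨w, hw, by rw [h, dist_eq_norm]⟩

theorem infDist_le (H : IsSharpRegular f g xbar δ η μ L Cb) (x : E d) :
    Metric.infDist x (solutionSet f) ≤ ‖x - xbar‖ := by
  rw [← dist_eq_norm]
  exact Metric.infDist_le_dist_of_mem H.sol

theorem norm_proj_sub_le (xbar : E d) {x w : E d}
    (hw : ‖x - w‖ = Metric.infDist x (solutionSet f)) :
    ‖w - xbar‖ ≤ ‖x - xbar‖ + Metric.infDist x (solutionSet f) := by
  have h1 : w - xbar = (x - xbar) - (x - w) := by abel
  rw [h1, ← hw]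
  exact norm_sub_le _ _

/-- The `(b)`-regularity estimate in terms of the gap. -/
theorem abs_gap_add_inner_le (H : IsSharpRegular f g xbar δ η μ L Cb) {x v w : E d}
    (hx : ‖x - xbar‖ < δ) (hv : v ∈ g x) (hw : w ∈ solutionSet f) (hwb : ‖w - xbar‖ < 2 * δ) :
    |gap f x + inner ℝ v (w - x)| ≤ Cb * ‖w - x‖ ^ (1 + η) := by
  have := H.breg x (by rwa [mem_ball_iff_norm]) v hv w ⟨hw, by rwa [mem_ball_iff_norm]⟩
  rw [gap]
  convert this using 2
  ring

theorem mul_infDist_le_gap (H : IsSharpRegular f g xbar δ η μ L Cb) {x : E d}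
    (hx : ‖x - xbar‖ < δ) : μ * Metric.infDist x (solutionSet f) ≤ gap f x :=
  H.sharp x (by rwa [mem_ball_iff_norm])

theorem norm_le (H : IsSharpRegular f g xbar δ η μ L Cb) {x v : E d}
    (hx : ‖x - xbar‖ < δ) (hv : v ∈ g x) : ‖v‖ ≤ L :=
  H.bound x (by rwa [mem_ball_iff_norm]) v hv

theorem gap_le_mul_infDist (H : IsSharpRegular f g xbar δ η μ L Cb) {x : E d}
    (hx : ‖x - xbar‖ + Metric.infDist x (solutionSet f) < δ) :
    gap f x ≤ L * Metric.infDist x (solutionSet f) := by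
  obtain ⟨w, hw, hwx⟩ := H.exists_proj x
  have h := H.lip x ?_ w ?_
  · rw [gap, optVal_eq hw, ← hwx]
    exact (le_abs_self _).trans h
  · rw [mem_ball_iff_norm]
    linarith [Metric.infDist_nonneg (x := x) (s := solutionSet f)]
  · rw [mem_ball_iff_norm]
    exact (norm_proj_sub_le xbar hwx).trans_lt hx

/-- A gradient has a component of size proportional to the gap towards the nearest minimizer. -/
theorem le_inner_proj (H : IsSharpRegular f g xbar δ η μ L Cb) {z v w : E d} {a : ℝ}
    (hz : ‖z - xbar‖ < δ) (hv : v ∈ g z) (hw : w ∈ solutionSet f)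
    (hwz : ‖z - w‖ = Metric.infDist z (solutionSet f))
    (ha : Cb * Metric.infDist z (solutionSet f) ^ η ≤ a * μ) (ha0 : 0 ≤ a) :
    (1 - a) * gap f z ≤ inner ℝ v (z - w) := by
  set r := Metric.infDist z (solutionSet f) with hr
  have hr0 : 0 ≤ r := Metric.infDist_nonneg
  have hrz := H.infDist_le z
  have hwb := norm_proj_sub_le xbar hwz
  have h := H.abs_gap_add_inner_le hz hv hw (by linarith)
  have hs := H.mul_infDist_le_gap hz
  have hη := H.hη
  rw [norm_sub_rev, hwz, Real.rpow_add_of_nonneg hr0 zero_le_one hη.le, Real.rpow_one] at h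
  have h1 : Cb * (r * r ^ η) ≤ a * gap f z := by
    calc Cb * (r * r ^ η) = (Cb * r ^ η) * r := by ring
      _ ≤ a * μ * r := by gcongr
      _ = a * (μ * r) := by ring
      _ ≤ a * gap f z := by gcongr
  have h2 := (abs_le.mp h).2
  have h3 : inner ℝ v (w - z) = - inner ℝ v (z - w) := by
    rw [← neg_sub, inner_neg_right]
  rw [h3] at h2
  linarith

/-! ### Superlinear improvement by PolyakBundle -/

/-- The size of the error of a bundle point in the span of the gradients, relative to
`dist(x, X⋆) ^ (1 + η)`: the error in the linearized equations at minimizers within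
`7 * dist(x, X⋆)`, times the condition number of the gradients. -/
noncomputable def errConst (d : ℕ) (η μ L Cb : ℝ) : ℝ :=
  condBound L (μ / 4) d * (Cb * 7 ^ (1 + η))

/-- As long as the bundle points have distance more than `distConst * dist(x, X⋆) ^ (1 + η)` from
the solution set, each new gradient is well separated from the span of the previous ones. -/
noncomputable def distConst (d : ℕ) (η μ L Cb : ℝ) : ℝ :=
  (4 * L / μ + 1) * errConst d η μ L Cb

theorem errConst_nonneg (H : IsSharpRegular f g xbar δ η μ L Cb) : 0 ≤ errConst d η μ L Cb := by
  have := H.hμ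
  have := H.hCb
  have := condBound_nonneg H.hL.le (show 0 < μ / 4 by positivity) d
  rw [errConst]
  positivity

theorem errConst_le_distConst (H : IsSharpRegular f g xbar δ η μ L Cb) :
    errConst d η μ L Cb ≤ distConst d η μ L Cb := by
  have := H.hμ
  have := H.hL
  have := H.errConst_nonneg
  rw [distConst]
  exact le_mul_of_one_le_left this (le_add_of_nonneg_left (by positivity))

/-- If a minimizer `w` has distance at most `7 * dist(x, X⋆)` from the points of a well-conditioned
bundle, then the `i`-th point agrees with `w` in the directions of the gradients, up to an error of
superlinear order. -/
theorem norm_starProjection_le (H : IsSharpRegular f g xbar δ η μ L Cb) {x : E d} {y v : ℕ → E d}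
    (h : IsBundleTrace f g x y v) {i : ℕ} (hi : i ≤ d) (hwc : WellConditioned v (μ / 4) i)
    (hy : ∀ j < i, ‖y j - xbar‖ < δ) {w : E d} (hw : w ∈ solutionSet f)
    (hwb : ‖w - xbar‖ < 2 * δ)
    (hyw : ∀ j < i, ‖w - y j‖ ≤ 7 * Metric.infDist x (solutionSet f)) :
    ‖(prefixSpan v i).starProjection (y i - w)‖ ≤
      errConst d η μ L Cb * Metric.infDist x (solutionSet f) ^ (1 + η) := by
  have hμ := H.hμ
  have hCb := H.hCb
  have hη := H.hη
  have hμ4 : 0 < μ / 4 := by positivity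
  set r := Metric.infDist x (solutionSet f) with hr
  have hr0 : 0 ≤ r := Metric.infDist_nonneg
  have key := norm_le_of_mem_prefixSpan (M := Cb * (7 * r) ^ (1 + η)) H.hL.le hμ4
    (fun j hj => H.norm_le (hy j hj) (h.eval j (by omega))) hwc
    (Submodule.starProjection_apply_mem (prefixSpan v i) (y i - w)) (fun j hj => by
      rw [← Submodule.inner_starProjection_left_eq_right,
        Submodule.starProjection_eq_self_iff.mpr (mem_prefixSpan v hj),
        h.inner_sub hi (hwc.linearIndependent hμ4) hj w, abs_neg]
      refine (H.abs_gap_add_inner_le (hy j hj) (h.eval j (by omega)) hw hwb).trans ?_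
      have := hyw j hj
      gcongr)
  refine key.trans ?_
  rw [Real.mul_rpow (by norm_num) hr0, errConst, mul_assoc, mul_assoc]
  have := condBound_mono H.hL.le hμ4 hi
  gcongr

/-- Under well-conditioning the bundle points stay within twice the distance to the solutions. -/
theorem norm_bundle_sub_le (H : IsSharpRegular f g xbar δ η μ L Cb) {x : E d} {y v : ℕ → E d}
    (h : IsBundleTrace f g x y v) (hx : ‖x - xbar‖ < δ / 4)
    (hr1 : distConst d η μ L Cb * Metric.infDist x (solutionSet f) ^ η < 1)
    {i : ℕ} (hi : i ≤ d) (hwc : WellConditioned v (μ / 4) i)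
    (hy : ∀ j < i, ‖y j - y 0‖ ≤ 2 * Metric.infDist x (solutionSet f)) :
    ‖y i - y 0‖ ≤ 2 * Metric.infDist x (solutionSet f) := by
  set r := Metric.infDist x (solutionSet f) with hr
  have hr0 : 0 ≤ r := Metric.infDist_nonneg
  have hrx := H.infDist_le x
  obtain ⟨w, hw, hwx⟩ := H.exists_proj x
  have hwb := norm_proj_sub_le xbar hwx
  have hyx : y 0 = x := h.start
  have hp := H.norm_starProjection_le h hi hwc (w := w) (fun j hj => by
    have h1 : y j - xbar = (y j - y 0) + (x - xbar) := by rw [hyx]; abel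
    rw [h1]
    linarith [norm_add_le (y j - y 0) (x - xbar), hy j hj]) hw (by linarith [H.hδ])
    (fun j hj => by
      have h1 : w - y j = -(y j - y 0) - (x - w) := by rw [hyx]; abel
      rw [h1]
      have := norm_sub_le (-(y j - y 0)) (x - w)
      rw [norm_neg] at this
      linarith [hy j hj])
  set S := prefixSpan v i
  have hmem : S.starProjection (y 0 - y i) = y 0 - y i :=
    Submodule.starProjection_eq_self_iff.mpr (h.sub_mem_prefixSpan hi)
  have hdec : y i - y 0 = S.starProjection (y i - w) - S.starProjection (x - w) := by
    rw [← map_sub, sub_sub_sub_cancel_right, ← hyx, ← neg_sub (y 0) (y i), map_neg, hmem]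
  have hsmall : errConst d η μ L Cb * r ^ (1 + η) ≤ r := by
    rw [Real.rpow_add_of_nonneg hr0 zero_le_one H.hη.le, Real.rpow_one]
    have : errConst d η μ L Cb * r ^ η ≤ 1 :=
      (mul_le_mul_of_nonneg_right H.errConst_le_distConst (by positivity)).trans hr1.le
    calc errConst d η μ L Cb * (r * r ^ η) = errConst d η μ L Cb * r ^ η * r := by ring
      _ ≤ 1 * r := by gcongr
      _ = r := one_mul r
  have h2 : ‖S.starProjection (x - w)‖ ≤ r :=
    (Submodule.norm_starProjection_apply_le _ _).trans hwx.le
  rw [hdec]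
  linarith [norm_sub_le (S.starProjection (y i - w)) (S.starProjection (x - w))]

/-- While the bundle points are not of superlinear quality, the gradients are well conditioned. -/
theorem wellConditioned_of_lt_infDist (H : IsSharpRegular f g xbar δ η μ L Cb) {x : E d}
    {y v : ℕ → E d} (h : IsBundleTrace f g x y v) (hx : ‖x - xbar‖ < δ / 4)
    (hr1 : distConst d η μ L Cb * Metric.infDist x (solutionSet f) ^ η < 1)
    (hr2 : Cb * (3 * Metric.infDist x (solutionSet f)) ^ η ≤ μ / 2)
    {i : ℕ} (hi : i ≤ d)
    (hs : ∀ j < i, distConst d η μ L Cb * Metric.infDist x (solutionSet f) ^ (1 + η) <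
      Metric.infDist (y j) (solutionSet f)) :
    WellConditioned v (μ / 4) i ∧
      ∀ j ≤ i, ‖y j - y 0‖ ≤ 2 * Metric.infDist x (solutionSet f) := by
  have hμ := H.hμ
  have hL := H.hL
  have hCb := H.hCb
  have hyx : y 0 = x := h.start
  set r := Metric.infDist x (solutionSet f) with hr
  have hr0 : 0 ≤ r := Metric.infDist_nonneg
  have hrx := H.infDist_le x
  induction i with
  | zero =>
    refine ⟨fun j hj => by omega, fun j hj => ?_⟩
    obtain rfl : j = 0 := by omega
    simpa using hr0
  | succ i ih =>
    obtain ⟨hwc, hy⟩ := ih (by omega) fun j hj => hs j (by omega)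
    suffices hi' : WellConditioned v (μ / 4) (i + 1) by
      refine ⟨hi', fun j hj => ?_⟩
      rcases Nat.lt_or_ge i j with hij | hij
      · obtain rfl : j = i + 1 := by omega
        exact H.norm_bundle_sub_le h hx hr1 hi hi' fun j hj => hy j (by omega)
      · exact hy j hij
    suffices hp : μ / 4 ≤ ‖orthPart v i‖ by
      intro j hj
      rcases Nat.lt_or_ge j i with hij | hij
      · exact hwc j hij
      · obtain rfl : j = i := by omega
        exact hp
    set s := Metric.infDist (y i) (solutionSet f) with hsdef
    have hyxb : ∀ j ≤ i, ‖y j - xbar‖ ≤ 2 * r + ‖x - xbar‖ := fun j hj => by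
      have h1 : y j - xbar = (y j - y 0) + (x - xbar) := by rw [hyx]; abel
      rw [h1]
      linarith [norm_add_le (y j - y 0) (x - xbar), hy j hj]
    have hs3 : s ≤ 3 * r := by
      have := Metric.infDist_le_infDist_add_dist (s := solutionSet f) (x := y i) (y := x)
      rw [dist_eq_norm, ← hyx] at this
      rw [hyx] at this
      have h0 := hy i le_rfl
      rw [hyx] at h0
      linarith
    obtain ⟨w, hw, hwy⟩ := H.exists_proj (y i)
    have hwb := norm_proj_sub_le xbar hwy
    have hyi := hyxb i le_rfl
    have hsi := H.infDist_le (y i)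
    have hin := H.le_inner_proj (a := 1 / 2) (by linarith) (h.eval i (by omega)) hw hwy (by
      refine le_trans ?_ (hr2.trans_eq (by ring))
      have : 0 ≤ Metric.infDist (y i) (solutionSet f) := Metric.infDist_nonneg
      have := H.hη
      gcongr) (by norm_num)
    -- All bundle points so far are within `2 * r` of `x`, and `w` is within `3 * r` of `y i`; this
    -- explains the constant `7 = 2 + 2 + 3`.
    have hproj := H.norm_starProjection_le h (by omega) hwc (fun j hj => by
        linarith [hyxb j hj.le]) hw (by linarith) (fun j hj => by
        have h1 : w - y j = (y i - y 0) - (y j - y 0) - (y i - w) := by abel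
        rw [h1]
        linarith [norm_sub_le (y i - y 0 - (y j - y 0)) (y i - w),
          norm_sub_le (y i - y 0) (y j - y 0), hy i le_rfl, hy j hj.le])
    set S := prefixSpan v i
    have hdec : inner ℝ (v i) (y i - w) =
        inner ℝ (orthPart v i) (y i - w) + inner ℝ (v i) (S.starProjection (y i - w)) := by
      rw [← Submodule.inner_starProjection_left_eq_right, ← inner_add_left, orthPart,
        sub_add_cancel]
    have h1 : inner ℝ (orthPart v i) (y i - w) ≤ ‖orthPart v i‖ * s := by
      rw [hsdef, ← hwy]; exact real_inner_le_norm _ _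
    have hvi : ‖v i‖ ≤ L := H.norm_le (by linarith) (h.eval i (by omega))
    have h2 : inner ℝ (v i) (S.starProjection (y i - w)) ≤
        L * (errConst d η μ L Cb * r ^ (1 + η)) :=
      (real_inner_le_norm _ _).trans (mul_le_mul hvi hproj (norm_nonneg _) hL.le)
    have hsi' := hs i (by omega)
    have h3 : L * (errConst d η μ L Cb * r ^ (1 + η)) ≤ μ / 4 * s := by
      have h4 : L * (errConst d η μ L Cb * r ^ (1 + η)) =
          μ / 4 * (4 * L / μ * errConst d η μ L Cb * r ^ (1 + η)) := by field_simp
      rw [h4]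
      have h5 : 4 * L / μ * errConst d η μ L Cb * r ^ (1 + η) ≤
          distConst d η μ L Cb * r ^ (1 + η) := by
        have := H.errConst_nonneg
        rw [distConst]
        gcongr
        linarith
      gcongr
      exact h5.trans hsi'.le
    have hs0 : 0 < s := by
      refine lt_of_le_of_lt ?_ hsi'
      have := H.errConst_nonneg.trans H.errConst_le_distConst
      positivity
    have hsh := H.mul_infDist_le_gap (x := y i) (by linarith)
    have h6 : μ / 4 * s ≤ ‖orthPart v i‖ * s := by linarith
    exact le_of_mul_le_mul_right h6 hs0

/-- One of the bundle points is a candidate of superlinear quality. -/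
theorem exists_bundle_index (H : IsSharpRegular f g xbar δ η μ L Cb) (hd : 0 < d) {x : E d}
    {y v : ℕ → E d} (h : IsBundleTrace f g x y v) (hx : ‖x - xbar‖ < δ / 4)
    (hr1 : distConst d η μ L Cb * Metric.infDist x (solutionSet f) ^ η < 1)
    (hr2 : Cb * (3 * Metric.infDist x (solutionSet f)) ^ η ≤ μ / 2)
    (hr0 : 0 < Metric.infDist x (solutionSet f)) :
    ∃ i, 1 ≤ i ∧ i ≤ d ∧ ‖y i - y 0‖ ≤ 2 * Metric.infDist x (solutionSet f) ∧
      Metric.infDist (y i) (solutionSet f) ≤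
        distConst d η μ L Cb * Metric.infDist x (solutionSet f) ^ (1 + η) := by
  classical
  set r := Metric.infDist x (solutionSet f) with hr
  have hyx : y 0 = x := h.start
  have hrx := H.infDist_le x
  have hpow : r ^ (1 + η) = r ^ η * r := by
    rw [add_comm, Real.rpow_add_one hr0.ne']
  have hs0 : distConst d η μ L Cb * r ^ (1 + η) < Metric.infDist (y 0) (solutionSet f) := by
    rw [hyx, ← hr, hpow, ← mul_assoc]
    exact (mul_lt_mul_of_pos_right hr1 hr0).trans_eq (one_mul r)
  -- Otherwise `d` independent gradients pin down the last point.
  have hex : ∃ i, 1 ≤ i ∧ i ≤ d ∧ Metric.infDist (y i) (solutionSet f) ≤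
      distConst d η μ L Cb * r ^ (1 + η) := by
    by_contra! hcon
    obtain ⟨hwc, hy⟩ := H.wellConditioned_of_lt_infDist h hx hr1 hr2 le_rfl fun j hj => by
      rcases Nat.eq_zero_or_pos j with rfl | hj0
      · exact hs0
      · exact hcon j hj0 hj.le
    obtain ⟨w, hw, hwx⟩ := H.exists_proj x
    have hwb := norm_proj_sub_le xbar hwx
    have hproj := H.norm_starProjection_le h le_rfl hwc (fun j hj => by
        have h1 : y j - xbar = (y j - y 0) + (x - xbar) := by rw [hyx]; abel
        rw [h1]
        linarith [norm_add_le (y j - y 0) (x - xbar), hy j hj.le]) hw (by linarith [H.hδ])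
      (fun j hj => by
        have h1 : w - y j = -(y j - y 0) - (x - w) := by rw [hyx]; abel
        rw [h1]
        have := norm_sub_le (-(y j - y 0)) (x - w)
        rw [norm_neg] at this
        linarith [hy j hj.le])
    rw [Submodule.starProjection_eq_self_iff.mpr (by
      rw [hwc.prefixSpan_eq_top hd (by linarith [H.hμ])]; trivial)] at hproj
    have h1 := Metric.infDist_le_dist_of_mem (x := y d) hw
    rw [dist_eq_norm] at h1
    have h2 := hcon d hd le_rfl
    have h3 : errConst d η μ L Cb * r ^ (1 + η) ≤ distConst d η μ L Cb * r ^ (1 + η) := by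
      have := H.errConst_le_distConst
      gcongr
    linarith
  obtain ⟨h1, h2, h3⟩ := Nat.find_spec hex
  refine ⟨Nat.find hex, h1, h2, ?_, h3⟩
  refine (H.wellConditioned_of_lt_infDist h hx hr1 hr2 h2 fun j hj => ?_).2 _ le_rfl
  rcases Nat.eq_zero_or_pos j with rfl | hj0
  · exact hs0
  · by_contra! hle
    exact Nat.find_min hex hj ⟨hj0, by omega, hle⟩

/-- Superlinear improvement in the region described by `hr1` and `hr2`. -/
theorem bundleOutput_superlinear (H : IsSharpRegular f g xbar δ η μ L Cb) (hd : 0 < d) {x : E d}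
    (hx : ‖x - xbar‖ < δ / 4)
    (hr1 : distConst d η μ L Cb * Metric.infDist x (solutionSet f) ^ η < 1)
    (hr2 : Cb * (3 * Metric.infDist x (solutionSet f)) ^ η ≤ μ / 2)
    {τ : ℝ} (hτ : 3 / μ ≤ τ) {o : Option (E d)} (ho : BundleOutput f g x τ o) :
    ∃ xt, o = some xt ∧
      gap f xt ≤ L * distConst d η μ L Cb / μ ^ (1 + η) * gap f x ^ (1 + η) := by
  have hμ := H.hμ
  have hL := H.hL
  have hD := H.errConst_nonneg.trans H.errConst_le_distConst
  have hη := H.hη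
  set C := L * distConst d η μ L Cb / μ ^ (1 + η) with hC
  have hC0 : 0 ≤ C := by positivity
  have hgx := H.gap_nonneg x
  have hτ0 : 0 ≤ τ := le_trans (by positivity) hτ
  suffices key : ∀ y v, IsBundleTrace f g x y v →
      ∃ i ∈ bundleCandidates f τ y, gap f (y i) ≤ C * gap f x ^ (1 + η) by
    cases ho with
    | point y v h s hs hmin =>
      obtain ⟨i, hi, hgi⟩ := key y v h
      refine ⟨y s, rfl, le_trans ?_ hgi⟩
      have := hmin i hi
      simp only [gap]
      linarith
    | empty y v h hempty =>
      obtain ⟨i, hi, -⟩ := key y v h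
      rw [hempty] at hi
      exact hi.elim
  intro y v h
  have hyx : y 0 = x := h.start
  set r := Metric.infDist x (solutionSet f) with hr
  have hrx := H.infDist_le x
  have hδ := H.hδ
  have hsh := H.mul_infDist_le_gap (x := x) (by linarith)
  rcases (Metric.infDist_nonneg : 0 ≤ r).eq_or_lt with hr0 | hr0
  · -- At a minimizer the first step is zero.
    have hg0 : gap f x = 0 := by
      refine le_antisymm ?_ hgx
      have := H.gap_le_mul_infDist (x := x) (by linarith)
      rwa [← hr0, mul_zero] at this
    have hy1 : y 1 = x := by
      have hres : residual f y v 1 = 0 := by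
        ext j
        simp [residual, hyx, hg0]
      have := h.update 1 le_rfl hd
      rwa [hres, Matrix.mulVec_zero, WithLp.toLp_zero, sub_zero, hyx] at this
    refine ⟨1, ⟨le_rfl, hd, ?_⟩, ?_⟩
    · rw [hy1, hyx, sub_self, norm_zero, hg0, mul_zero]
    · rw [hy1, hg0, Real.zero_rpow (by linarith), mul_zero]
  · obtain ⟨i, hi1, hi2, hi3, hi4⟩ := H.exists_bundle_index hd h hx hr1 hr2 hr0
    refine ⟨i, ⟨hi1, hi2, ?_⟩, ?_⟩
    · calc ‖y i - y 0‖ ≤ 2 * r := hi3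
        _ ≤ 3 * r := by linarith
        _ = 3 / μ * (μ * r) := by field_simp
        _ ≤ τ * gap f x := by gcongr
        _ = τ * gap f (y 0) := by rw [hyx]
    · have hpow : r ^ (1 + η) = r ^ η * r := by
        rw [add_comm, Real.rpow_add_one hr0.ne']
      have hsr : Metric.infDist (y i) (solutionSet f) ≤ r := by
        refine hi4.trans ?_
        rw [hpow, ← mul_assoc]
        exact (mul_le_mul_of_nonneg_right hr1.le hr0.le).trans_eq (one_mul r)
      have hyi : ‖y i - xbar‖ ≤ 2 * r + ‖x - xbar‖ := by
        have h1 : y i - xbar = (y i - y 0) + (x - xbar) := by rw [hyx]; abel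
        rw [h1]
        linarith [norm_add_le (y i - y 0) (x - xbar)]
      have hg := H.gap_le_mul_infDist (x := y i) (by linarith)
      calc gap f (y i) ≤ L * Metric.infDist (y i) (solutionSet f) := hg
        _ ≤ L * (distConst d η μ L Cb * r ^ (1 + η)) := by gcongr
        _ = C * (μ * r) ^ (1 + η) := by
            have : μ ^ (1 + η) ≠ 0 := (Real.rpow_pos_of_pos hμ _).ne'
            rw [hC, Real.mul_rpow hμ.le hr0.le, ← mul_assoc (L * _ / _), div_mul_cancel₀ _ this,
              mul_assoc]
        _ ≤ C * gap f x ^ (1 + η) := by gcongr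

end IsSharpRegular

/-- Constants of superlinear improvement that do not depend on the function. -/
theorem exists_superlinear {d : ℕ} (hd : 0 < d) {η μ L Cb : ℝ} (hη : 0 < η) (hμ : 0 < μ)
    (hL : 0 < L) (hCb : 0 < Cb) :
    ∃ C₁ r₀ : ℝ, 1 ≤ C₁ ∧ 0 < r₀ ∧ ∀ (f : E d → ℝ) (g : E d → Set (E d)) (xbar : E d) (δ : ℝ),
      IsSharpRegular f g xbar δ η μ L Cb → ∀ (τ : ℝ) (x : E d), 3 / μ ≤ τ → ‖x - xbar‖ < δ / 4 →
        Metric.infDist x (solutionSet f) ≤ r₀ → ∀ o, BundleOutput f g x τ o →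
          ∃ xt, o = some xt ∧ gap f xt ≤ C₁ * gap f x ^ (1 + η) := by
  set D := IsSharpRegular.distConst d η μ L Cb with hDdef
  have hD : 0 ≤ D := by
    have := condBound_nonneg hL.le (show 0 < μ / 4 by positivity) d
    rw [hDdef, IsSharpRegular.distConst, IsSharpRegular.errConst]
    positivity
  refine ⟨max 1 (L * D / μ ^ (1 + η)),
    min ((D + 1)⁻¹ ^ (1 / η) / 2) ((μ / (2 * Cb)) ^ (1 / η) / 3), le_max_left _ _,
    by positivity, fun f g xbar δ H τ x hτ hx hr o ho => ?_⟩
  have hr0 : 0 ≤ Metric.infDist x (solutionSet f) := Metric.infDist_nonneg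
  have hinv : ∀ a : ℝ, 0 ≤ a → (a ^ (1 / η)) ^ η = a := fun a ha => by
    rw [← Real.rpow_mul ha, one_div_mul_cancel hη.ne', Real.rpow_one]
  have ha1 : (0 : ℝ) < (D + 1)⁻¹ := by positivity
  obtain ⟨xt, hxt, hg⟩ := H.bundleOutput_superlinear hd hx (by
      have h1 : Metric.infDist x (solutionSet f) ≤ (D + 1)⁻¹ ^ (1 / η) := by
        have := hr.trans (min_le_left _ _)
        have : 0 < (D + 1)⁻¹ ^ (1 / η) := by positivity
        linarith
      have h2 : Metric.infDist x (solutionSet f) ^ η ≤ (D + 1)⁻¹ := by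
        rw [← hinv _ ha1.le]
        gcongr
      calc D * Metric.infDist x (solutionSet f) ^ η ≤ D * (D + 1)⁻¹ := by gcongr
        _ < 1 := by rw [mul_inv_lt_iff₀ (by positivity)]; linarith) (by
      have h1 : 3 * Metric.infDist x (solutionSet f) ≤ (μ / (2 * Cb)) ^ (1 / η) := by
        have := hr.trans (min_le_right _ _)
        linarith
      have h2 : (3 * Metric.infDist x (solutionSet f)) ^ η ≤ μ / (2 * Cb) := by
        rw [← hinv (μ / (2 * Cb)) (by positivity)]
        gcongr
      calc Cb * (3 * Metric.infDist x (solutionSet f)) ^ η ≤ Cb * (μ / (2 * Cb)) := by gcongr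
        _ = μ / 2 := by field_simp) hτ ho
  refine ⟨xt, hxt, hg.trans ?_⟩
  have := H.gap_nonneg x
  gcongr
  exact le_max_right _ _

/-! ### The Polyak subgradient method -/

theorem rho_nonneg (κ : ℝ) : 0 ≤ rho κ := Real.sqrt_nonneg _

theorem rho_sq {κ : ℝ} (hκ : 1 ≤ κ) : rho κ ^ 2 = 1 - ((2 * κ) ^ 2)⁻¹ := by
  have : ((2 * κ) ^ 2)⁻¹ ≤ 1 := inv_le_one_of_one_le₀ (one_le_pow₀ (by linarith))
  rw [rho, Real.sq_sqrt (by linarith)]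

theorem rho_lt_one {κ : ℝ} (hκ : 0 < κ) : rho κ < 1 := by
  have h : 0 < ((2 * κ) ^ 2)⁻¹ := by positivity
  rw [rho, Real.sqrt_lt' one_pos]
  linarith

theorem half_lt_rho {κ : ℝ} (hκ : 1 ≤ κ) : 1 / 2 < rho κ := by
  have h : ((2 * κ) ^ 2)⁻¹ ≤ 4⁻¹ := by
    apply inv_anti₀ (by norm_num)
    nlinarith
  nlinarith [rho_sq hκ, rho_nonneg κ]

theorem rho_pow_le {κ : ℝ} (hκ : 1 ≤ κ) {n : ℕ} (hn : 8 * κ ^ 2 * Real.log (2 * κ) ≤ n) :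
    rho κ ^ n ≤ (2 * κ)⁻¹ := by
  have hκ0 : 0 < κ := by linarith
  set t := (8 * κ ^ 2)⁻¹ with ht
  have h1 : rho κ ≤ Real.exp (-t) := by
    have h2 : rho κ ^ 2 ≤ Real.exp (-t) ^ 2 := by
      rw [rho_sq hκ, ← Real.exp_nat_mul]
      have h3 : ((2 : ℕ) : ℝ) * -t = -((2 * κ) ^ 2)⁻¹ := by
        rw [ht]; push_cast; field_simp; norm_num
      rw [h3]
      linarith [Real.add_one_le_exp (-((2 * κ) ^ 2)⁻¹)]
    exact (pow_le_pow_iff_left₀ (rho_nonneg κ) (Real.exp_pos _).le two_ne_zero).mp h2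
  calc rho κ ^ n ≤ Real.exp (-t) ^ n := pow_le_pow_left₀ (rho_nonneg κ) h1 n
    _ = Real.exp (-(n * t)) := by rw [← Real.exp_nat_mul]; ring_nf
    _ ≤ Real.exp (-Real.log (2 * κ)) := by
        apply Real.exp_le_exp.mpr
        rw [neg_le_neg_iff, ht, ← div_eq_mul_inv, le_div_iff₀ (by positivity)]
        linarith
    _ = (2 * κ)⁻¹ := by rw [Real.exp_neg, Real.exp_log (by positivity)]

namespace IsSharpRegular

variable {d : ℕ} {f : E d → ℝ} {g : E d → Set (E d)} {xbar : E d} {δ η μ L Cb : ℝ}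

/-- The condition number is at least one. -/
theorem one_le_condition (H : IsSharpRegular f g xbar δ η μ L Cb) {x : E d}
    (hx : ‖x - xbar‖ < δ / 2) (hgx : 0 < gap f x) : 1 ≤ L / μ := by
  have hrx := H.infDist_le x
  have h1 := H.mul_infDist_le_gap (x := x) (by linarith [H.hδ])
  have h2 := H.gap_le_mul_infDist (x := x) (by linarith)
  have h3 : 0 < Metric.infDist x (solutionSet f) :=
    pos_of_mul_pos_right (hgx.trans_le h2) H.hL.le
  rw [one_le_div H.hμ]
  exact le_of_mul_le_mul_right (h1.trans h2) h3

theorem ne_zero_of_gap_pos (H : IsSharpRegular f g xbar δ η μ L Cb) {z v : E d}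
    (hz : ‖z - xbar‖ < δ) (hr : Cb * Metric.infDist z (solutionSet f) ^ η ≤ μ / 4)
    (hg : 0 < gap f z) (hv : v ∈ g z) : v ≠ 0 := by
  rintro rfl
  obtain ⟨w, hw, hwz⟩ := H.exists_proj z
  have := H.le_inner_proj (a := 1 / 4) hz hv hw hwz (by linarith) (by norm_num)
  rw [inner_zero_left] at this
  linarith

/-- A Polyak step contracts the distance to the solution set. -/
theorem infDist_polyakStep_le (H : IsSharpRegular f g xbar δ η μ L Cb) {z v : E d}
    (hκ : 1 ≤ L / μ) (hz : ‖z - xbar‖ < δ)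
    (hr : Cb * Metric.infDist z (solutionSet f) ^ η ≤ μ / 4) (hv : v ∈ g z) (hv0 : v ≠ 0) :
    Metric.infDist (polyakStep f z v) (solutionSet f) ≤
        rho (L / μ) * Metric.infDist z (solutionSet f) ∧
      ‖polyakStep f z v - z‖ ≤ (1 + rho (L / μ)) * Metric.infDist z (solutionSet f) := by
  have hμ := H.hμ
  have hL := H.hL
  obtain ⟨w, hw, hwz⟩ := H.exists_proj z
  have hin := H.le_inner_proj (a := 1 / 4) hz hv hw hwz (by linarith) (by norm_num)
  have hsh := H.mul_infDist_le_gap hz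
  have hvL := H.norm_le hz hv
  set r := Metric.infDist z (solutionSet f) with hrdef
  have hr0 : 0 ≤ r := Metric.infDist_nonneg
  have hvp : 0 < ‖v‖ := norm_pos_iff.mpr hv0
  set γ := gap f z with hγ
  have hγ0 : 0 ≤ γ := H.gap_nonneg z
  have hsq : ‖polyakStep f z v - w‖ ^ 2 ≤ (rho (L / μ) * r) ^ 2 := by
    have h1 : polyakStep f z v - w = (z - w) - (γ / ‖v‖ ^ 2) • v := by rw [polyakStep]; abel
    rw [h1, norm_sub_sq_real, inner_smul_right, norm_smul, Real.norm_eq_abs, mul_pow, sq_abs,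
      hwz, mul_pow (rho _), rho_sq hκ, real_inner_comm]
    have h2 : (γ / ‖v‖ ^ 2) ^ 2 * ‖v‖ ^ 2 = γ / ‖v‖ ^ 2 * γ := by field_simp
    have h3 : γ / ‖v‖ ^ 2 * ((1 - 1 / 4) * γ) ≤ γ / ‖v‖ ^ 2 * inner ℝ v (z - w) := by gcongr
    have h4 : (μ * r) * (μ * r) / L ^ 2 ≤ γ / ‖v‖ ^ 2 * γ := by
      rw [div_mul_eq_mul_div]
      gcongr
    have h5 : ((2 * (L / μ)) ^ 2)⁻¹ * r ^ 2 = (μ * r) * (μ * r) / L ^ 2 / 4 := by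
      field_simp
      ring
    have h6 : 0 ≤ (μ * r) * (μ * r) / L ^ 2 := by positivity
    rw [h2, sub_mul, h5]
    linarith
  have hle : ‖polyakStep f z v - w‖ ≤ rho (L / μ) * r :=
    (pow_le_pow_iff_left₀ (norm_nonneg _) (mul_nonneg (rho_nonneg _) hr0) two_ne_zero).mp hsq
  refine ⟨?_, ?_⟩
  · have := Metric.infDist_le_dist_of_mem (x := polyakStep f z v) hw
    rw [dist_eq_norm] at this
    exact this.trans hle
  · have h1 : polyakStep f z v - z = (polyakStep f z v - w) - (z - w) := by abel
    rw [h1]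
    linarith [norm_sub_le (polyakStep f z v - w) (z - w)]

end IsSharpRegular

/-! ### Invariants of the runs of the algorithm -/

/-- A radius containing the `k`-th iterate: moves by PolyakBundle add up to the terms with `Δ`,
moves by PolyakSGM to those with `a`. -/
noncomputable def iterRadius (D Δ a : ℝ) (k : ℕ) : ℝ :=
  D + 4 * Δ * (1 - (3 / 4) ^ k) + a * (1 - (1 / 2) ^ k)

/-- The bound for the total displacement by PolyakSGM, for the initial gap `Δ`. -/
noncomputable def sgmTravel (κ μ Δ : ℝ) : ℝ := (1 + rho κ) / (1 - rho κ) * (2 * Δ / μ)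

/-- A schedule of gap bounds: `B k` bounds the gap of the `k`-th iterate of every run from `x₀`, it
is compatible with halving the gap for `k < N`, PolyakBundle is bound to succeed for `k ≥ N`, and
`T` iterations suffice. -/
structure IsSchedule {d : ℕ} (f : E d → ℝ) (g : E d → Set (E d)) (xbar : E d) (δ ε : ℝ)
    (x₀ : E d) (B : ℕ → ℝ) (N T : ℕ) : Prop where
  pos : 1 ≤ T
  start : gap f x₀ ≤ B 0
  half : ∀ k < N, B k / 2 ≤ B (k + 1)
  bundle : ∀ k, N ≤ k → ∀ x, ‖x - xbar‖ < δ / 4 → 0 < gap f x →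
    gap f x ≤ gap f x₀ * (1 / 2) ^ k → gap f x ≤ B k →
    ∀ o, BundleOutput f g x ((3 / 2) ^ k) o →
      ∃ xt, o = some xt ∧ gap f xt < 1 / 2 * gap f x ∧ gap f xt ≤ B (k + 1)
  final : B T ≤ ε

/-- What is known when iteration `k` starts at `x` after `n` evaluations of `g`. Every iteration
costs `d` evaluations, and at most `S` more if PolyakSGM is called. -/
structure IterInv {d : ℕ} (f : E d → ℝ) (xbar : E d) (R : ℕ → ℝ) (Δ : ℝ) (B : ℕ → ℝ)
    (N T S k : ℕ) (x : E d) (n : ℕ) : Prop where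
  lt : k < T
  pos : 0 < gap f x
  gap_le : gap f x ≤ Δ * (1 / 2) ^ k
  gap_le' : gap f x ≤ B k
  norm_le : ‖x - xbar‖ ≤ R k
  evals : n ≤ d * k + S * min k N

/-- The invariant of the configurations of a run. In the fallback state, `i` is the number of steps
that PolyakSGM has made. -/
def RunInv {d : ℕ} (f : E d → ℝ) (xbar : E d) (R : ℕ → ℝ) (Δ : ℝ) (B : ℕ → ℝ)
    (N T S : ℕ) (ε ρ : ℝ) : Config d → Prop
  | ⟨.main k x, n⟩ => IterInv f xbar R Δ B N T S k x n
  | ⟨.fallback k x z, n⟩ => k < N ∧ ∃ n₀ i, IterInv f xbar R Δ B N T S k x n₀ ∧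
      n = n₀ + d + i ∧ i < S ∧ 0 < gap f z ∧
      Metric.infDist z (solutionSet f) ≤ ρ ^ i * Metric.infDist x (solutionSet f) ∧
      ‖z - x‖ ≤ (1 + ρ) / (1 - ρ) * (1 - ρ ^ i) * Metric.infDist x (solutionSet f)
  | ⟨.returned x, n⟩ => gap f x ≤ ε ∧ n ≤ d * T + S * min T N

theorem BundleOutput.norm_sub_le {d : ℕ} {f : E d → ℝ} {g : E d → Set (E d)} {x xt : E d} {τ : ℝ}
    (h : BundleOutput f g x τ (some xt)) : ‖xt - x‖ ≤ τ * gap f x := by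
  cases h with
  | point y v h s hs hmin => rw [← h.start]; exact hs.2.2

/-- The end of an iteration preserves the invariant. -/
theorem IterInv.finish {d : ℕ} {f : E d → ℝ} {xbar : E d} {R : ℕ → ℝ} {Δ : ℝ} {B : ℕ → ℝ}
    {N T S k n n' : ℕ} {ε ρ : ℝ} {x xt : E d} (hI : IterInv f xbar R Δ B N T S k x n) (hε : 0 < ε)
    (hT : B T ≤ ε) (h1 : gap f xt ≤ 1 / 2 * gap f x) (h2 : gap f xt ≤ B (k + 1))
    (h3 : ‖xt - x‖ ≤ R (k + 1) - R k) (h4 : n' ≤ d * (k + 1) + S * min (k + 1) N) :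
    RunInv f xbar R Δ B N T S ε ρ ⟨finish f ε k xt, n'⟩ := by
  have hk := hI.lt
  unfold SuperPolyak.finish
  split_ifs with hgap
  · refine ⟨hgap, h4.trans ?_⟩
    have : min (k + 1) N ≤ min T N := min_le_min_right _ hk
    gcongr
    exact hk
  · rw [not_le] at hgap
    refine ⟨?_, hε.trans hgap, ?_, h2, ?_, h4⟩
    · by_contra hcon
      obtain rfl : T = k + 1 := by omega
      linarith
    · have := hI.gap_le
      rw [pow_succ]
      linarith
    · have h5 : xt - xbar = (xt - x) + (x - xbar) := by abel
      rw [h5]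
      linarith [norm_add_le (xt - x) (x - xbar), hI.norm_le]

namespace IsSharpRegular

variable {d : ℕ} {f : E d → ℝ} {g : E d → Set (E d)} {xbar : E d} {δ η μ L Cb : ℝ}

theorem runInv_step (H : IsSharpRegular f g xbar δ η μ L Cb) {ε : ℝ} (hε : 0 < ε) {x₀ : E d}
    {B : ℕ → ℝ} {N T S : ℕ} (hB : IsSchedule f g xbar δ ε x₀ B N T) (hκ : 1 ≤ L / μ)
    (hS : 8 * (L / μ) ^ 2 * Real.log (2 * (L / μ)) ≤ S)
    {D : ℝ} (hΔ : 0 ≤ gap f x₀)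
    (hR : D + 4 * gap f x₀ + sgmTravel (L / μ) μ (gap f x₀) < δ / 4)
    (hr : Cb * (gap f x₀ / μ) ^ η ≤ μ / 4) {c c' : Config d}
    (hc : RunInv f xbar (iterRadius D (gap f x₀) (sgmTravel (L / μ) μ (gap f x₀)))
      (gap f x₀) B N T S ε (rho (L / μ)) c) (hs : Step f g ε c c') :
    RunInv f xbar (iterRadius D (gap f x₀) (sgmTravel (L / μ) μ (gap f x₀)))
      (gap f x₀) B N T S ε (rho (L / μ)) c' := by
  have hμ := H.hμ
  have hL := H.hL
  have hη := H.hη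
  have hCb := H.hCb
  have hρ0 := rho_nonneg (L / μ)
  have hρ1 := rho_lt_one (zero_lt_one.trans_le hκ)
  set Δ := gap f x₀ with hΔdef
  set ρ := rho (L / μ) with hρ
  set a := sgmTravel (L / μ) μ Δ with ha
  have hA0 : 0 ≤ (1 + ρ) / (1 - ρ) := div_nonneg (by linarith) (by linarith)
  have ha' : a = (1 + ρ) / (1 - ρ) * (2 * Δ / μ) := rfl
  have ha0 : 0 ≤ a := by rw [ha']; positivity
  have hS1 : 1 ≤ S := by
    have : 0 < Real.log (2 * (L / μ)) := Real.log_pos (by linarith)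
    have : (0 : ℝ) < S := lt_of_lt_of_le (by positivity) hS
    exact_mod_cast this
  -- The increments of the radius leave room for the moves of either subroutine.
  have hRb : ∀ k, Δ * (3 / 4) ^ k ≤ iterRadius D Δ a (k + 1) - iterRadius D Δ a k := fun k => by
    have : 0 ≤ a * (1 / 2) ^ k := by positivity
    simp only [iterRadius, pow_succ]
    linarith
  have hRs : ∀ k, (1 + ρ) / (1 - ρ) * (Δ * (1 / 2) ^ k / μ) ≤
      iterRadius D Δ a (k + 1) - iterRadius D Δ a k := fun k => by
    have h1 : 0 ≤ Δ * (3 / 4) ^ k := by positivity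
    have h2 : (1 + ρ) / (1 - ρ) * (Δ * (1 / 2) ^ k / μ) = a * (1 / 2) ^ k / 2 := by
      rw [ha']; ring
    rw [h2]
    simp only [iterRadius, pow_succ]
    linarith
  have hRlt : ∀ k, iterRadius D Δ a k < δ / 4 := fun k => by
    have h1 : 0 ≤ Δ * (3 / 4) ^ k := by positivity
    have h2 : 0 ≤ a * (1 / 2) ^ k := by positivity
    simp only [iterRadius]
    linarith
  have hRmove : ∀ k, iterRadius D Δ a k +
      (1 + ρ) / (1 - ρ) * (Δ * (1 / 2) ^ k / μ) < δ / 4 := fun k => by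
    have h1 : 0 ≤ Δ * (3 / 4) ^ (k + 1) := by positivity
    have h2 : 0 ≤ a * (1 / 2) ^ (k + 1) := by positivity
    have h3 := hRs k
    simp only [iterRadius] at h3 ⊢
    linarith
  have hdist : ∀ k x n, IterInv f xbar (iterRadius D Δ a) Δ B N T S k x n →
      Metric.infDist x (solutionSet f) ≤ Δ * (1 / 2) ^ k / μ := fun k x n hI => by
    rw [le_div_iff₀ hμ, mul_comm]
    refine (H.mul_infDist_le_gap ?_).trans hI.gap_le
    linarith [hI.norm_le, hRlt k, H.hδ]
  -- Facts on the current point of PolyakSGM.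
  have hfb : ∀ k x z n i, IterInv f xbar (iterRadius D Δ a) Δ B N T S k x n →
      Metric.infDist z (solutionSet f) ≤ ρ ^ i * Metric.infDist x (solutionSet f) →
      ‖z - x‖ ≤ (1 + ρ) / (1 - ρ) * (1 - ρ ^ i) * Metric.infDist x (solutionSet f) →
      ‖z - x‖ ≤ (1 + ρ) / (1 - ρ) * (Δ * (1 / 2) ^ k / μ) ∧ ‖z - xbar‖ < δ / 4 ∧
        Cb * Metric.infDist z (solutionSet f) ^ η ≤ μ / 4 := by
    intro k x z n i hI hz1 hz2
    have hx0 : 0 ≤ Metric.infDist x (solutionSet f) := Metric.infDist_nonneg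
    have hz0 : 0 ≤ Metric.infDist z (solutionSet f) := Metric.infDist_nonneg
    have hd := hdist k x n hI
    have hpow : 0 ≤ ρ ^ i := by positivity
    have hmove : ‖z - x‖ ≤ (1 + ρ) / (1 - ρ) * (Δ * (1 / 2) ^ k / μ) := by
      refine hz2.trans ?_
      rw [mul_assoc]
      gcongr
      refine (mul_le_of_le_one_left hx0 (by linarith)).trans hd
    refine ⟨hmove, ?_, ?_⟩
    · have h1 : z - xbar = (z - x) + (x - xbar) := by abel
      rw [h1]
      linarith [norm_add_le (z - x) (x - xbar), hI.norm_le, hRmove k]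
    · refine le_trans ?_ hr
      have h1 : Δ * (1 / 2) ^ k / μ ≤ Δ / μ := by
        gcongr
        exact mul_le_of_le_one_right hΔ (pow_le_one₀ (by norm_num) (by norm_num))
      have h2 : Metric.infDist z (solutionSet f) ≤ Δ / μ :=
        hz1.trans ((mul_le_of_le_one_left hx0 (pow_le_one₀ hρ0 hρ1.le)).trans (hd.trans h1))
      gcongr
  -- One more step of PolyakSGM.
  have hstep : ∀ k x z v n i, IterInv f xbar (iterRadius D Δ a) Δ B N T S k x n →
      Metric.infDist z (solutionSet f) ≤ ρ ^ i * Metric.infDist x (solutionSet f) →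
      ‖z - x‖ ≤ (1 + ρ) / (1 - ρ) * (1 - ρ ^ i) * Metric.infDist x (solutionSet f) →
      v ∈ g z → v ≠ 0 →
      Metric.infDist (polyakStep f z v) (solutionSet f) ≤
          ρ ^ (i + 1) * Metric.infDist x (solutionSet f) ∧
        ‖polyakStep f z v - x‖ ≤
          (1 + ρ) / (1 - ρ) * (1 - ρ ^ (i + 1)) * Metric.infDist x (solutionSet f) := by
    intro k x z v n i hI hz1 hz2 hv hv0
    obtain ⟨-, hz3, hz4⟩ := hfb k x z n i hI hz1 hz2
    obtain ⟨h1, h2⟩ := H.infDist_polyakStep_le hκ (by linarith [H.hδ]) hz4 hv hv0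
    refine ⟨?_, ?_⟩
    · refine h1.trans ?_
      rw [pow_succ', mul_assoc]
      gcongr
    · have h3 : polyakStep f z v - x = (polyakStep f z v - z) + (z - x) := by abel
      have h4 : (1 + ρ) * Metric.infDist z (solutionSet f) ≤
          (1 + ρ) * (ρ ^ i * Metric.infDist x (solutionSet f)) := by gcongr
      have h5 : (1 + ρ) / (1 - ρ) * (1 - ρ ^ (i + 1)) * Metric.infDist x (solutionSet f) =
          (1 + ρ) * (ρ ^ i * Metric.infDist x (solutionSet f)) +
          (1 + ρ) / (1 - ρ) * (1 - ρ ^ i) * Metric.infDist x (solutionSet f) := by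
        have : 1 - ρ ≠ 0 := by linarith
        field_simp
        ring
      rw [h3, h5]
      exact (norm_add_le _ _).trans (add_le_add (h2.trans h4) hz2)
  cases hs with
  | bundle_success k x xt n ho h =>
    have hI : IterInv f xbar (iterRadius D Δ a) Δ B N T S k x n := hc
    obtain ⟨xt', hxt, hhalf⟩ := h
    obtain rfl : xt = xt' := Option.some.inj hxt
    have hev := hI.evals
    refine hI.finish hε hB.final hhalf.le ?_ ?_ ?_
    · rcases Nat.lt_or_ge k N with hk | hk
      · linarith [hB.half k hk, hI.gap_le']
      · obtain ⟨xt', hxt', -, h2⟩ := hB.bundle k hk x (hI.norm_le.trans_lt (hRlt k)) hI.pos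
          hI.gap_le hI.gap_le' _ ho
        obtain rfl : xt = xt' := Option.some.inj hxt'
        exact h2
    · refine ho.norm_sub_le.trans (le_trans ?_ (hRb k))
      calc (3 / 2 : ℝ) ^ k * gap f x ≤ (3 / 2 : ℝ) ^ k * (Δ * (1 / 2) ^ k) := by
            gcongr
            exact hI.gap_le
        _ = Δ * (3 / 2 * (1 / 2)) ^ k := by rw [mul_pow]; ring
        _ = Δ * (3 / 4) ^ k := by norm_num
    · have h1 : S * min k N ≤ S * min (k + 1) N := by gcongr; omega
      have h2 : d * (k + 1) = d * k + d := by ring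
      omega
  | bundle_failure k x o n ho h =>
    have hI : IterInv f xbar (iterRadius D Δ a) Δ B N T S k x n := hc
    refine ⟨?_, n, 0, hI, rfl, hS1, hI.pos, by simp, by simp⟩
    by_contra! hk
    obtain ⟨xt, rfl, h1, -⟩ := hB.bundle k hk x (hI.norm_le.trans_lt (hRlt k)) hI.pos
      hI.gap_le hI.gap_le' _ ho
    exact h ⟨xt, rfl, h1⟩
  | sgm_zero k x z n hv =>
    obtain ⟨-, n₀, i, hI, -, -, hz0, hz1, hz2⟩ := hc
    obtain ⟨-, hz3, hz4⟩ := hfb k x z n₀ i hI hz1 hz2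
    exact (H.ne_zero_of_gap_pos (by linarith [H.hδ]) hz4 hz0 hv rfl).elim
  | sgm_halved k x z v n hv hv0 h =>
    obtain ⟨hk, n₀, i, hI, hn, hi, hz0, hz1, hz2⟩ := hc
    obtain ⟨h1, h2⟩ := hstep k x z v n₀ i hI hz1 hz2 hv hv0
    have hmove := (hfb k x _ n₀ (i + 1) hI h1 h2).1
    refine hI.finish hε hB.final h ?_ (hmove.trans (hRs k)) ?_
    · linarith [hB.half k hk, hI.gap_le']
    · have h3 := hI.evals
      have h4 : S * min (k + 1) N = S * min k N + S := by
        rw [min_eq_left (by omega : k + 1 ≤ N), min_eq_left hk.le]; ring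
      have h5 : d * (k + 1) = d * k + d := by ring
      omega
  | sgm_continue k x z v n hv hv0 h =>
    obtain ⟨hk, n₀, i, hI, hn, hi, hz0, hz1, hz2⟩ := hc
    obtain ⟨h1, h2⟩ := hstep k x z v n₀ i hI hz1 hz2 hv hv0
    have hzb := (hfb k x _ n₀ (i + 1) hI h1 h2).2.1
    rw [not_le] at h
    have hpos := hI.pos
    refine ⟨hk, n₀, i + 1, hI, by omega, ?_, by linarith, h1, h2⟩
    -- After `S` steps the gap would have been halved.
    by_contra! hcon
    obtain rfl : S = i + 1 := by omega
    have hx0 : 0 ≤ Metric.infDist x (solutionSet f) := Metric.infDist_nonneg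
    have h3 := H.gap_le_mul_infDist (x := polyakStep f z v) (by
      linarith [H.infDist_le (polyakStep f z v), H.hδ])
    have h4 : ρ ^ (i + 1) ≤ (2 * (L / μ))⁻¹ := rho_pow_le hκ hS
    have h5 := H.mul_infDist_le_gap (x := x) (by linarith [hI.norm_le, hRlt k, H.hδ])
    have h6 : gap f (polyakStep f z v) ≤ 1 / 2 * gap f x := by
      calc gap f (polyakStep f z v)
          ≤ L * (ρ ^ (i + 1) * Metric.infDist x (solutionSet f)) := h3.trans (by gcongr)
        _ ≤ L * ((2 * (L / μ))⁻¹ * Metric.infDist x (solutionSet f)) := by gcongr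
        _ = 1 / 2 * (μ * Metric.infDist x (solutionSet f)) := by field_simp
        _ ≤ 1 / 2 * gap f x := by gcongr
    linarith
  | idle x n => exact hc

/-- A schedule bounds the number of evaluations of every run. -/
theorem terminatesWithin_of_schedule (H : IsSharpRegular f g xbar δ η μ L Cb) (hd : 0 < d)
    {ε : ℝ} (hε : 0 < ε) {x₀ : E d} (hx₀ : 0 < gap f x₀)
    {B : ℕ → ℝ} {N T S : ℕ} (hB : IsSchedule f g xbar δ ε x₀ B N T) (hκ : 1 ≤ L / μ)
    (hS : 8 * (L / μ) ^ 2 * Real.log (2 * (L / μ)) ≤ S)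
    (hR : ‖x₀ - xbar‖ + 4 * gap f x₀ + sgmTravel (L / μ) μ (gap f x₀) < δ / 4)
    (hr : Cb * (gap f x₀ / μ) ^ η ≤ μ / 4) :
    TerminatesWithin f g ε x₀ ((d * T + S * min T N : ℕ) : ℝ) := by
  intro s hs
  have hinv : ∀ m, RunInv f xbar
      (iterRadius ‖x₀ - xbar‖ (gap f x₀) (sgmTravel (L / μ) μ (gap f x₀)))
      (gap f x₀) B N T S ε (rho (L / μ)) (s m) := by
    intro m
    induction m with
    | zero =>
      rw [hs.init]
      exact ⟨hB.pos, hx₀, by simp, hB.start, by simp [iterRadius], by simp⟩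
    | succ m ih => exact H.runInv_step hε hB hκ hS hx₀.le hR hr ih (hs.step m)
  -- Every step before the return makes an evaluation, and their number is bounded.
  have hgrow : ∀ m, (∃ x, (s m).control = .returned x) ∨ m ≤ (s m).evals := by
    intro m
    induction m with
    | zero => right; omega
    | succ m ih =>
      have hst := hs.step m
      generalize s m = c at hst ih
      generalize s (m + 1) = c' at hst
      cases hst <;> simp_all <;> omega
  set m := d * T + S * T + d + S + 1 with hm
  have hret : ∃ x, (s m).control = .returned x := by
    rcases hgrow m with h | h
    · exact h
    · have hi := hinv m
      have hbound : ∀ k x n, IterInv f xbar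
          (iterRadius ‖x₀ - xbar‖ (gap f x₀) (sgmTravel (L / μ) μ (gap f x₀)))
          (gap f x₀) B N T S k x n → n ≤ d * T + S * T := fun k x n hI => by
        have h1 : d * k ≤ d * T := Nat.mul_le_mul_left _ hI.lt.le
        have h2 : S * min k N ≤ S * T :=
          Nat.mul_le_mul_left _ ((min_le_left _ _).trans hI.lt.le)
        have := hI.evals
        omega
      rcases hsm : s m with ⟨k, x⟩ | ⟨k, x, z⟩ | x
      all_goals rename_i n; rw [hsm] at hi h
      · have := hbound k x n hi
        simp only at h
        omega
      · obtain ⟨-, n₀, i, hI, hn, hiS, -⟩ := hi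
        have := hbound k x n₀ hI
        simp only at h
        omega
      · exact ⟨x, rfl⟩
  obtain ⟨x, hx⟩ := hret
  have hi := hinv m
  refine ⟨m, x, hx, ?_⟩
  generalize s m = c at hi hx ⊢
  obtain ⟨c, n⟩ := c
  simp only at hx
  subst hx
  exact ⟨hi.1, by exact_mod_cast hi.2⟩

end IsSharpRegular

/-! ### The initialization -/

theorem one_le_initFactor {κ L : ℝ} (hL : 0 ≤ L) : 1 ≤ initFactor κ L := by
  rw [initFactor]
  have := le_max_right (2 * κ * ((1 + rho κ) / (1 - rho κ))) (4 * L / 3)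
  linarith

namespace IsSharpRegular

variable {d : ℕ} {f : E d → ℝ} {g : E d → Set (E d)} {xbar : E d} {δ η μ L Cb : ℝ}

/-- The initialization bounds keep every run in the region where the estimates hold. -/
theorem init_bounds (H : IsSharpRegular f g xbar δ η μ L Cb) {x₀ : E d}
    (hx₀ : x₀ ∉ solutionSet f)
    (h1 : ‖x₀ - xbar‖ ≤ (2 / (1 - rho (L / μ)) * initFactor (L / μ) L)⁻¹ * (δ / 4))
    (h2 : Metric.infDist x₀ (solutionSet f) ≤
      1 / initFactor (L / μ) L * (μ / (4 * Cb)) ^ (1 / η)) :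
    1 ≤ L / μ ∧ gap f x₀ ≤ L * (μ / (4 * Cb)) ^ (1 / η) ∧
      ‖x₀ - xbar‖ + 4 * gap f x₀ + sgmTravel (L / μ) μ (gap f x₀) < δ / 4 ∧
      Cb * (gap f x₀ / μ) ^ η ≤ μ / 4 := by
  have hμ := H.hμ
  have hL := H.hL
  have hη := H.hη
  have hCb := H.hCb
  have hδ := H.hδ
  have hκ0 : 0 < L / μ := by positivity
  have hρ0 := rho_nonneg (L / μ)
  have hρ1 := rho_lt_one hκ0
  have hθ : 1 ≤ initFactor (L / μ) L := one_le_initFactor hL.le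
  set θ := initFactor (L / μ) L with hθdef
  set ρ := rho (L / μ) with hρ
  have hθD : θ * ‖x₀ - xbar‖ ≤ (1 - ρ) / 2 * (δ / 4) := by
    have : (2 / (1 - ρ) * θ)⁻¹ = (1 - ρ) / 2 / θ := by
      rw [mul_inv, inv_div, div_eq_mul_inv ((1 - ρ) / 2)]
    rw [this, div_mul_eq_mul_div, le_div_iff₀ (by linarith)] at h1
    linarith
  have hn := norm_nonneg (x₀ - xbar)
  have hD : ‖x₀ - xbar‖ ≤ δ / 8 := by
    have h3 : ‖x₀ - xbar‖ ≤ θ * ‖x₀ - xbar‖ := le_mul_of_one_le_left hn hθ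
    have h4 : (1 - ρ) / 2 * (δ / 4) ≤ 1 / 2 * (δ / 4) := by
      have : 0 ≤ δ / 4 := by positivity
      gcongr
      linarith
    linarith
  have hr0 : 0 ≤ Metric.infDist x₀ (solutionSet f) := Metric.infDist_nonneg
  have hrD := H.infDist_le x₀
  have hκ := H.one_le_condition (by linarith) (H.gap_pos hx₀)
  have hgr := H.gap_le_mul_infDist (x := x₀) (by linarith)
  have hpow : 0 ≤ (μ / (4 * Cb)) ^ (1 / η) := by positivity
  -- The two terms of the maximum in `θ` control the moves of the two subroutines.
  have hm1 : 2 * (L / μ) * ((1 + ρ) / (1 - ρ)) ≤ θ - 1 := by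
    have := le_max_left (2 * (L / μ) * ((1 + ρ) / (1 - ρ))) (4 * L / 3)
    rw [hθdef, initFactor]
    linarith
  have hm2 : 4 * L / 3 ≤ θ - 1 := by
    have := le_max_right (2 * (L / μ) * ((1 + ρ) / (1 - ρ))) (4 * L / 3)
    rw [hθdef, initFactor]
    linarith
  have hA : 1 ≤ (1 + ρ) / (1 - ρ) := by
    rw [one_le_div (by linarith)]
    linarith
  have hκθ : L / μ ≤ θ := by
    have : 2 * (L / μ) * 1 ≤ 2 * (L / μ) * ((1 + ρ) / (1 - ρ)) := by gcongr
    linarith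
  refine ⟨hκ, ?_, ?_, ?_⟩
  · refine hgr.trans ?_
    have : 1 / θ * (μ / (4 * Cb)) ^ (1 / η) ≤ (μ / (4 * Cb)) ^ (1 / η) :=
      mul_le_of_le_one_left hpow (by rw [div_le_one (by linarith)]; exact hθ)
    gcongr
    exact h2.trans this
  · have hgD : gap f x₀ ≤ L * ‖x₀ - xbar‖ := hgr.trans (by gcongr)
    have hs : sgmTravel (L / μ) μ (gap f x₀) ≤ (θ - 1) * ‖x₀ - xbar‖ := by
      calc sgmTravel (L / μ) μ (gap f x₀)
          ≤ (1 + ρ) / (1 - ρ) * (2 * (L * ‖x₀ - xbar‖) / μ) := by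
            rw [sgmTravel]
            gcongr
        _ = 2 * (L / μ) * ((1 + ρ) / (1 - ρ)) * ‖x₀ - xbar‖ := by ring
        _ ≤ _ := by gcongr
    have hb : 4 * gap f x₀ ≤ 3 * ((θ - 1) * ‖x₀ - xbar‖) := by
      calc 4 * gap f x₀ ≤ 4 * (L * ‖x₀ - xbar‖) := by gcongr
        _ = 3 * (4 * L / 3 * ‖x₀ - xbar‖) := by ring
        _ ≤ _ := by gcongr
    have hhalf := half_lt_rho hκ
    have h4 : 4 * (θ * ‖x₀ - xbar‖) ≤ 2 * (1 - ρ) * (δ / 4) := by linarith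
    have h5 : 2 * (1 - ρ) * (δ / 4) < 1 * (δ / 4) := by
      apply mul_lt_mul_of_pos_right _ (by positivity)
      linarith
    linarith
  · have h3 : gap f x₀ / μ ≤ (μ / (4 * Cb)) ^ (1 / η) := by
      calc gap f x₀ / μ ≤ L * Metric.infDist x₀ (solutionSet f) / μ := by gcongr
        _ = L / μ * Metric.infDist x₀ (solutionSet f) := by ring
        _ ≤ θ * (1 / θ * (μ / (4 * Cb)) ^ (1 / η)) := by gcongr
        _ = (μ / (4 * Cb)) ^ (1 / η) := by field_simp
    have h4 : 0 ≤ gap f x₀ / μ := div_nonneg (H.gap_nonneg x₀) hμ.le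
    calc Cb * (gap f x₀ / μ) ^ η ≤ Cb * ((μ / (4 * Cb)) ^ (1 / η)) ^ η := by gcongr
      _ = Cb * (μ / (4 * Cb)) := by
          rw [← Real.rpow_mul (by positivity), one_div_mul_cancel hη.ne', Real.rpow_one]
      _ = μ / 4 := by field_simp

end IsSharpRegular

/-! ### Schedules and the complexity bound -/

/-- A uniform rate: below the gap `Γ`, PolyakBundle raises the gap, relative to `c`, to the power
`1 + η`. -/
theorem exists_superlinear_rate {d : ℕ} (hd : 0 < d) {η μ L Cb : ℝ} (hη : 0 < η) (hμ : 0 < μ)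
    (hL : 0 < L) (hCb : 0 < Cb) :
    ∃ C₁ r₀ c Γ : ℝ, 1 ≤ C₁ ∧ 0 < r₀ ∧ 0 < c ∧ c ≤ 1 ∧ 0 < Γ ∧ Γ ≤ c / 2 ∧
      ∀ (f : E d → ℝ) (g : E d → Set (E d)) (xbar : E d) (δ : ℝ),
        IsSharpRegular f g xbar δ η μ L Cb → ∀ (τ : ℝ) (x : E d), 3 / μ ≤ τ →
          ‖x - xbar‖ < δ / 4 → ∀ o, BundleOutput f g x τ o →
          (Metric.infDist x (solutionSet f) ≤ r₀ →
            ∃ xt, o = some xt ∧ gap f xt ≤ C₁ * gap f x ^ (1 + η)) ∧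
          (0 < gap f x → gap f x ≤ Γ → ∀ e : ℝ, gap f x ≤ c * (1 / 2) ^ e →
            ∃ xt, o = some xt ∧ gap f xt < 1 / 2 * gap f x ∧
              gap f xt ≤ c * (1 / 2) ^ (e * (1 + η))) := by
  obtain ⟨C₁, r₀, hC₁, hr₀, key⟩ := exists_superlinear (d := d) hd hη hμ hL hCb
  have hC0 : 0 < C₁ := by linarith
  set c := C₁ ^ (-(1 / η)) with hc
  have hc0 : 0 < c := by positivity
  have hcη : C₁ * c ^ η = 1 := by
    rw [hc, ← Real.rpow_mul hC0.le, neg_mul, one_div_mul_cancel hη.ne', Real.rpow_neg_one,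
      mul_inv_cancel₀ hC0.ne']
  have hc1 : c ≤ 1 := Real.rpow_le_one_of_one_le_of_nonpos hC₁ (by simp [hη.le])
  clear_value c
  have h4η : ((1 / 4 : ℝ) ^ (1 / η)) ^ η = 1 / 4 := by
    rw [← Real.rpow_mul (by norm_num), one_div_mul_cancel hη.ne', Real.rpow_one]
  refine ⟨C₁, r₀, c, min (μ * r₀) (min (c / 2) (c * (1 / 4) ^ (1 / η))), hC₁, hr₀, hc0, hc1,
    by positivity,
    (min_le_right _ _).trans (min_le_left _ _), ?_⟩
  intro f g xbar δ H τ x hτ hx o ho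
  refine ⟨fun hr => key f g xbar δ H τ x hτ hx hr o ho, fun hg0 hgΓ e he => ?_⟩
  have hg1 := hgΓ.trans (min_le_left _ _)
  have hg2 := hgΓ.trans ((min_le_right _ _).trans (min_le_right _ _))
  obtain ⟨xt, hxt, hg⟩ := key f g xbar δ H τ x hτ hx (by
    have := H.mul_infDist_le_gap (x := x) (by linarith [H.hδ])
    exact le_of_mul_le_mul_left (this.trans hg1) hμ) o ho
  refine ⟨xt, hxt, lt_of_le_of_lt hg ?_, hg.trans ?_⟩
  · rw [add_comm 1 η, Real.rpow_add_one hg0.ne', ← mul_assoc]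
    have : C₁ * gap f x ^ η ≤ 1 / 4 := by
      calc C₁ * gap f x ^ η ≤ C₁ * (c * (1 / 4) ^ (1 / η)) ^ η := by gcongr
        _ = (C₁ * c ^ η) * (1 / 4) := by
            rw [Real.mul_rpow hc0.le (by positivity), h4η, mul_assoc]
        _ = 1 / 4 := by rw [hcη, one_mul]
    gcongr
    exact this.trans_lt (by norm_num)
  · calc C₁ * gap f x ^ (1 + η) ≤ C₁ * (c * (1 / 2) ^ e) ^ (1 + η) := by gcongr
      _ = (C₁ * c ^ η) * (c * (1 / 2) ^ (e * (1 + η))) := by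
          rw [Real.mul_rpow hc0.le (by positivity), ← Real.rpow_mul (by norm_num), add_comm 1 η,
            Real.rpow_add_one hc0.ne']
          ring
      _ = _ := by rw [hcη, one_mul]

/-- The count of the second phase is a positive natural number `M`, such that `M` superlinear
improvements starting from `1 / 2` give the precision `ε`. -/
theorem exists_superlinearCount {η ε : ℝ} (hη : 0 < η) (hε : 0 < ε) :
    ∃ M : ℕ, 1 ≤ M ∧ (superlinearCount η ε : ℝ) = M ∧ (1 / 2 : ℝ) ^ ((1 + η) ^ M : ℝ) ≤ ε := by
  rw [superlinearCount]
  split_ifs with h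
  · have hl : 1 < Real.logb 2 (1 / ε) := by
      rw [Real.lt_logb_iff_rpow_lt (by norm_num) (by positivity), Real.rpow_one,
        lt_one_div (by norm_num) hε]
      exact h
    set ℓ := Real.logb 2 (1 / ε) with hℓ
    have hlog : 0 < Real.log (1 + η) := Real.log_pos (by linarith)
    have hpos : 0 < Real.log ℓ / Real.log (1 + η) := div_pos (Real.log_pos hl) hlog
    refine ⟨⌈Real.log ℓ / Real.log (1 + η)⌉₊, Nat.ceil_pos.mpr hpos,
      (natCast_ceil_eq_intCast_ceil hpos.le).symm, ?_⟩
    set M := ⌈Real.log ℓ / Real.log (1 + η)⌉₊ with hM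
    have h1 : ℓ ≤ (1 + η) ^ M := by
      have := Nat.le_ceil (Real.log ℓ / Real.log (1 + η))
      rw [div_le_iff₀ hlog] at this
      rw [← Real.log_le_log_iff (by linarith) (by positivity), Real.log_pow]
      exact this
    calc (1 / 2 : ℝ) ^ ((1 + η) ^ M : ℝ) ≤ (1 / 2 : ℝ) ^ ℓ :=
          Real.rpow_le_rpow_of_exponent_ge (by norm_num) (by norm_num) h1
      _ = ((2 : ℝ) ^ ℓ)⁻¹ := by rw [one_div, Real.inv_rpow (by norm_num)]
      _ = ε := by
          rw [hℓ, Real.rpow_logb (by norm_num) (by norm_num) (by positivity), one_div, inv_inv]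
  · refine ⟨1, le_rfl, by norm_num, ?_⟩
    rw [not_lt] at h
    refine le_trans ?_ h
    rw [pow_one]
    calc (1 / 2 : ℝ) ^ (1 + η) ≤ (1 / 2 : ℝ) ^ (1 : ℝ) :=
          Real.rpow_le_rpow_of_exponent_ge (by norm_num) (by norm_num) (by linarith)
      _ = 1 / 2 := Real.rpow_one _

/-- For a tiny initial gap only the parameter of PolyakBundle delays its success, and this delay is
absorbed by the second phase. -/
theorem isSchedule_of_gap_le {d : ℕ} {f : E d → ℝ} {g : E d → Set (E d)} {xbar x₀ : E d}
    {δ η μ ε c Γ : ℝ} {n M : ℕ} (hη : 0 < η) (hn : 3 / μ ≤ (3 / 2 : ℝ) ^ n) (hc0 : 0 < c)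
    (hc1 : c ≤ 1)
    (hrate : ∀ (τ : ℝ) (x : E d), 3 / μ ≤ τ → ‖x - xbar‖ < δ / 4 →
      ∀ o, BundleOutput f g x τ o → 0 < gap f x → gap f x ≤ Γ →
        ∀ e : ℝ, gap f x ≤ c * (1 / 2) ^ e →
          ∃ xt, o = some xt ∧ gap f xt < 1 / 2 * gap f x ∧
            gap f xt ≤ c * (1 / 2) ^ (e * (1 + η)))
    (hx₀ : 0 ≤ gap f x₀) (hΓ : gap f x₀ ≤ Γ)
    (hx₀c : gap f x₀ ≤ c * (1 / 2 : ℝ) ^ ((1 + η) ^ n : ℝ))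
    (hM1 : 1 ≤ M) (hM : (1 / 2 : ℝ) ^ ((1 + η) ^ M : ℝ) ≤ ε) :
    IsSchedule f g xbar δ ε x₀ (fun k => c * (1 / 2 : ℝ) ^ ((1 + η) ^ max k n : ℝ)) n M where
  pos := hM1
  start := by simpa using hx₀c
  half k hk := by
    rw [max_eq_right hk.le, max_eq_right (by omega)]
    have : 0 < c * (1 / 2 : ℝ) ^ ((1 + η) ^ n : ℝ) := by positivity
    linarith
  bundle k hk x hx hg0 hg1 hg2 o ho := by
    rw [max_eq_left hk] at hg2
    rw [max_eq_left (by omega), pow_succ]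
    refine hrate _ x (hn.trans ?_) hx o ho hg0 (hg1.trans (le_trans ?_ hΓ)) _ hg2
    · gcongr
      norm_num
    · exact mul_le_of_le_one_right hx₀ (pow_le_one₀ (by norm_num) (by norm_num))
  final := by
    refine le_trans ?_ hM
    refine (mul_le_of_le_one_left (by positivity) hc1).trans ?_
    refine Real.rpow_le_rpow_of_exponent_ge (by norm_num) (by norm_num) ?_
    exact pow_le_pow_right₀ (by linarith) (le_max_left _ _)

/-- In general `W` halvings of the gap are followed by the second phase. -/
theorem isSchedule_of_halving {d : ℕ} {f : E d → ℝ} {g : E d → Set (E d)} {xbar x₀ : E d}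
    {δ η μ ε c Γ : ℝ} {W M : ℕ} (hW : 3 / μ ≤ (3 / 2 : ℝ) ^ W) (hc1 : c ≤ 1)
    (hΓc : Γ ≤ c / 2)
    (hrate : ∀ (τ : ℝ) (x : E d), 3 / μ ≤ τ → ‖x - xbar‖ < δ / 4 →
      ∀ o, BundleOutput f g x τ o → 0 < gap f x → gap f x ≤ Γ →
        ∀ e : ℝ, gap f x ≤ c * (1 / 2) ^ e →
          ∃ xt, o = some xt ∧ gap f xt < 1 / 2 * gap f x ∧
            gap f xt ≤ c * (1 / 2) ^ (e * (1 + η)))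
    (hx₀ : 0 ≤ gap f x₀) (hΓ : gap f x₀ * (1 / 2) ^ W ≤ Γ)
    (hM1 : 1 ≤ M) (hM : (1 / 2 : ℝ) ^ ((1 + η) ^ M : ℝ) ≤ ε) :
    IsSchedule f g xbar δ ε x₀ (fun k => if k < W then gap f x₀ * (1 / 2) ^ k
      else c * (1 / 2 : ℝ) ^ ((1 + η) ^ (k - W) : ℝ)) W (W + M) where
  pos := by omega
  start := by
    split_ifs with h
    · simp
    · obtain rfl : W = 0 := by omega
      simp only [pow_zero, mul_one] at hΓ
      simp only [Nat.sub_self, pow_zero, Real.rpow_one]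
      linarith
  half k hk := by
    rw [if_pos hk]
    split_ifs with h
    · rw [pow_succ]; linarith
    · obtain rfl : W = k + 1 := by omega
      rw [Nat.sub_self, pow_zero, Real.rpow_one]
      rw [pow_succ] at hΓ
      linarith
  bundle k hk x hx hg0 hg1 hg2 o ho := by
    rw [if_neg (by omega)] at hg2
    rw [if_neg (by omega), Nat.sub_add_comm hk, pow_succ]
    refine hrate _ x (hW.trans ?_) hx o ho hg0 (hg1.trans (le_trans ?_ hΓ)) _ hg2
    · gcongr
      norm_num
    · gcongr gap f x₀ * ?_
      exact pow_le_pow_of_le_one (by norm_num) (by norm_num) hk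
  final := by
    rw [if_neg (by omega), Nat.add_sub_cancel_left]
    exact (mul_le_of_le_one_left (by positivity) hc1).trans hM

theorem TerminatesWithin.mono {d : ℕ} {f : E d → ℝ} {g : E d → Set (E d)} {ε : ℝ} {x₀ : E d}
    {N N' : ℝ} (h : TerminatesWithin f g ε x₀ N) (hN : N ≤ N') : TerminatesWithin f g ε x₀ N' :=
  fun s hs => by
    obtain ⟨n, x, h1, h2, h3⟩ := h s hs
    exact ⟨n, x, h1, h2, h3.trans hN⟩

end SuperPolyak

open SuperPolyak
theorem mainTheorem4 (d : ℕ) (hd : 0 < d) (η μ L Cb : ℝ) (hη : 0 < η) (hμ : 0 < μ) (hL : 0 < L)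
    (hCb : 0 < Cb) :
    ∃ Cs : ℝ, 0 < Cs ∧
      ∀ (f : E d → ℝ) (g : E d → Set (E d)) (xbar : E d) (δ : ℝ),
        0 < δ → LocallyLipschitz f → xbar ∈ solutionSet f →
        Sharp f xbar δ μ →
        (∀ x, (g x).Nonempty) → MapsBoundedToBounded g → BRegular f g xbar δ Cb η →
        (∀ x ∈ Metric.ball xbar δ, ∀ v ∈ g x, ‖v‖ ≤ L) →
        (∀ x ∈ Metric.ball xbar δ, ∀ y ∈ Metric.ball xbar δ, |f x - f y| ≤ L * ‖x - y‖) →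
        IsSuperlinearConstant f g xbar δ μ L Cb η Cs ∧
        ∀ x₀ : E d, x₀ ∉ solutionSet f →
          ‖x₀ - xbar‖ ≤ (2 / (1 - rho (L / μ)) * initFactor (L / μ) L)⁻¹ * (δ / 4) →
          Metric.infDist x₀ (solutionSet f) ≤
            1 / initFactor (L / μ) L * (μ / (4 * Cb)) ^ (1 / η) →
          ∀ ε : ℝ, 0 < ε →
            TerminatesWithin f g ε x₀
              (max (d : ℝ) ⌈8 * (L / μ) ^ 2 * Real.log (2 * (L / μ))⌉ *
                  max (0 : ℝ) (K₁ (gap f x₀) μ L Cb η Cs) +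
                d * superlinearCount η ε) := by
  obtain ⟨C₁, r₀, c, Γ, hC₁, hr₀, hc0, hc1, hΓ0, hΓc, key⟩ :=
    exists_superlinear_rate (d := d) hd hη hμ hL hCb
  set n := ⌈Real.logb (3 / 2) (3 / μ)⌉₊ with hn
  have hnτ : 3 / μ ≤ (3 / 2 : ℝ) ^ n := by
    have h := Nat.le_ceil (Real.logb (3 / 2) (3 / μ))
    rwa [Real.logb_le_iff_le_rpow (by norm_num) (by positivity), Real.rpow_natCast] at h
  -- `W` halvings bring every admissible initial gap below `Γ`.
  obtain ⟨W, hnW, hW⟩ : ∃ W, n ≤ W ∧ L * (μ / (4 * Cb)) ^ (1 / η) * (1 / 2) ^ W ≤ Γ := by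
    have h := (tendsto_pow_atTop_nhds_zero_of_lt_one (r := (1 / 2 : ℝ)) (by norm_num)
      (by norm_num)).const_mul (L * (μ / (4 * Cb)) ^ (1 / η))
    rw [mul_zero] at h
    obtain ⟨W, h1, h2⟩ :=
      ((Filter.eventually_ge_atTop n).and (h.eventually_le_const hΓ0)).exists
    exact ⟨W, h1, h2⟩
  set Γ' := min Γ (c * (1 / 2 : ℝ) ^ ((1 + η) ^ n : ℝ)) with hΓ'
  have hΓ'0 : 0 < Γ' := by positivity
  -- The last term makes the first phase count at least `2 * W` unless the initial gap is tiny.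
  set Cs := max C₁ (max (μ ^ (1 - η) / (L * r₀ ^ η)) ((2 ^ (2 * W) / Γ') ^ η)) with hCs
  have hCs1 : C₁ ≤ Cs := le_max_left _ _
  have hCs2 : μ ^ (1 - η) / (L * r₀ ^ η) ≤ Cs := (le_max_left _ _).trans (le_max_right _ _)
  have hCs3 : (2 ^ (2 * W) / Γ') ^ η ≤ Cs := (le_max_right _ _).trans (le_max_right _ _)
  have hCs0 : 0 < Cs := by linarith
  have hηinv : ∀ a : ℝ, 0 ≤ a → (a ^ η) ^ (1 / η) = a := fun a ha => by
    rw [← Real.rpow_mul ha, mul_one_div_cancel hη.ne', Real.rpow_one]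
  have hCsr : (μ ^ (1 - η) / (L * Cs)) ^ (1 / η) ≤ r₀ := by
    rw [← hηinv r₀ hr₀.le]
    gcongr
    rw [div_le_iff₀ (by positivity)] at hCs2 ⊢
    linarith
  refine ⟨Cs, hCs0, fun f g xbar δ hδ hf hsol hsharp _ _ hb hbound hlip => ?_⟩
  have H : IsSharpRegular f g xbar δ η μ L Cb :=
    ⟨hη, hμ, hL, hCb, hδ, hf.continuous, hsol, hsharp, hb, hbound, hlip⟩
  have hrate := key f g xbar δ H
  refine ⟨fun τ hτ x hx hr o ho => ?_, fun x₀ hx₀ hi1 hi2 ε hε => ?_⟩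
  · obtain ⟨xt, hxt, hg⟩ :=
      (hrate τ x hτ.le hx o ho).1 ((hr.trans (min_le_right _ _)).trans hCsr)
    refine ⟨xt, hxt, hg.trans ?_⟩
    have := H.gap_nonneg x
    gcongr
  · obtain ⟨hκ, hΔ, hR, hr⟩ := H.init_bounds hx₀ hi1 hi2
    have hg0 := H.gap_pos hx₀
    obtain ⟨M, hM1, hMeq, hM⟩ := exists_superlinearCount hη hε
    have hrate' := fun τ x h1 h2 o ho => (hrate τ x h1 h2 o ho).2
    have hlog : 0 < Real.log (2 * (L / μ)) := Real.log_pos (by linarith)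
    set S := ⌈8 * (L / μ) ^ 2 * Real.log (2 * (L / μ))⌉₊ with hS
    have hSle : 8 * (L / μ) ^ 2 * Real.log (2 * (L / μ)) ≤ S := Nat.le_ceil _
    rw [hMeq, ← natCast_ceil_eq_intCast_ceil (by positivity), ← hS]
    set K := K₁ (gap f x₀) μ L Cb η Cs with hK
    have hd0 : (0 : ℝ) ≤ d := Nat.cast_nonneg d
    have hm1 := le_max_left (d : ℝ) S
    have hm2 := le_max_right (d : ℝ) S
    have hK0 := le_max_left (0 : ℝ) K
    rcases le_or_gt (gap f x₀) Γ' with hsmall | hlarge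
    · have hsch := isSchedule_of_gap_le (ε := ε) hη hnτ hc0 hc1 hrate' hg0.le
        (hsmall.trans (min_le_left _ _)) (hsmall.trans (min_le_right _ _)) hM1 hM
      refine (H.terminatesWithin_of_schedule hd hε hg0 hsch hκ hSle hR hr).mono ?_
      have hnK : (n : ℝ) ≤ max (0 : ℝ) K := by
        have h1 : Real.logb (3 / 2) (3 / μ) ≤ (K : ℝ) :=
          (le_max_right _ _).trans (Int.le_ceil _)
        have h2 : n ≤ K.toNat := by
          refine Nat.ceil_le.mpr (h1.trans ?_)
          exact_mod_cast Int.self_le_toNat K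
        have h3 : ((K.toNat : ℤ) : ℝ) = max (0 : ℝ) K := by
          rw [Int.toNat_eq_max, max_comm]
          push_cast
          rfl
        rw [← h3]
        exact_mod_cast h2
      have hmin : ((min M n : ℕ) : ℝ) ≤ n := by exact_mod_cast min_le_right M n
      push_cast at hmin ⊢
      calc (d : ℝ) * M + S * min (M : ℝ) n ≤ d * M + max (d : ℝ) S * max (0 : ℝ) K := by
            gcongr
            exact hmin.trans hnK
        _ = _ := add_comm _ _
    · have hsch := isSchedule_of_halving (ε := ε)
        (hnτ.trans (by gcongr; norm_num : (3 / 2 : ℝ) ^ n ≤ (3 / 2 : ℝ) ^ W)) hc1 hΓc hrate'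
        hg0.le (le_trans (by gcongr) hW) hM1 hM
      refine (H.terminatesWithin_of_schedule hd hε hg0 hsch hκ hSle hR hr).mono ?_
      have hWK : 2 * (W : ℝ) ≤ max (0 : ℝ) K := by
        refine le_trans ?_ (le_max_right _ _)
        refine le_trans ?_ ((le_max_left _ _).trans (Int.le_ceil _))
        have h1 : 2 ^ (2 * W) / Γ' ≤ (2 * Cs) ^ (1 / η) := by
          rw [← hηinv (2 ^ (2 * W) / Γ') (by positivity)]
          gcongr
          linarith
        have h2 : (2 : ℝ) ^ (2 * W) ≤ gap f x₀ * (2 * (2 * Cs) ^ (1 / η)) := by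
          have h3 : 0 ≤ (2 * Cs) ^ (1 / η) := by positivity
          rw [div_le_iff₀ hΓ'0] at h1
          calc (2 : ℝ) ^ (2 * W) ≤ (2 * Cs) ^ (1 / η) * Γ' := h1
            _ ≤ (2 * Cs) ^ (1 / η) * gap f x₀ := by gcongr
            _ ≤ gap f x₀ * (2 * (2 * Cs) ^ (1 / η)) := by
                have : 0 ≤ gap f x₀ * (2 * Cs) ^ (1 / η) := by positivity
                linarith
        rw [Real.le_logb_iff_rpow_le (by norm_num) (by positivity)]
        have h4 : (2 : ℝ) ^ (2 * (W : ℝ)) = 2 ^ (2 * W) := by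
          rw [← Real.rpow_natCast]; push_cast; rfl
        rw [h4]
        refine h2.trans ?_
        gcongr
        exact (le_max_left _ _).trans (le_max_left _ _)
      have hmin : min (W + M) W = W := by omega
      rw [hmin]
      push_cast
      calc (d : ℝ) * (W + M) + S * W = (d + S) * W + d * M := by ring
        _ ≤ (max (d : ℝ) S + max (d : ℝ) S) * W + d * M := by gcongr
        _ = max (d : ℝ) S * (2 * W) + d * M := by ring
        _ ≤ _ := by gcongr
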